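/- Let $P,K,q\ge 1$ be integers and, for $p=1,\dots,P$, let $0\le \ell_p\le m_p$ be integers; set $L=\ell_1+\dots+\ell_P$ and $M=m_1+\dots+m_P$. Consider $P$ parties, where party $p$ consists of $K$ blocks $A_{p,1},\dots,A_{p,K}$ of $m_p$ qudits of local dimension $q$ each, and let $\mathcal{H}$ be the Hilbert space of all these qudits, so that $\dim\mathcal H=q^{MK}$. For a subset $C$ of the $M$ qudits of one copy $A_{1,k}\cdots A_{P,k}$, let $$\mathcal{T}_C(X)=\int_{\mathcal{U}(C)} U_C^{\otimes K}\,X\,(U_C^{\dagger})^{\otimes K}\,dU$$ be the $K$-fold twirl over $C$, where $dU$ is the Haar probability measure on the unitary group of $C$, and where $U_C^{\otimes K}$ acts as $U$ on the qudits in $C$ of each of the $K$ copies and trivially on all other qudits. Put $$\mathcal{P}=\bigotimes_{p=1}^P\mathcal{T}_{A_p},\qquad \mathcal{Q}=\mathcal{T}_{A_1^{\ell_1}\cdots A_P^{\ell_P}},\qquad \mathcal{R}=\mathcal{T}_{A_1\cdots A_P},$$ where $A_p^{\ell_p}$ denotes the first $\ell_p$ qudits of party $p$ in a copy ($\mathcal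 Q$ is the crosstwirl). Equip the operators on $\mathcal H$ with the Hilbert--Schmidt inner product $\langle X,Y\rangle=\operatorname{tr}(X^\dagger Y)$ and norm $\|\cdot\|_2$, and let $\|\Phi\|_{2\to2}=\sup_{X\ne0}\|\Phi(X)\|_2/\|X\|_2$. For subspaces $V,W$ let the subspace angle be $c(V,W)=\sup|\langle x,y\rangle|$ over $x\in V\cap(V\cap W)^\perp$, $y\in W\cap(V\cap W)^\perp$ with $\|x\|_2,\|y\|_2\le1$. Assume that $K\le q^{m_p}$ and $K^2<2q^{m_p}$ for all $p$, that $K\le q^L$, and that $K^2<2q^L$. Then both $c(\operatorname{im}\mathcal P,\operatorname{im}\mathcal Q)^2$ and $\|\mathcal{Q}\mathcal{P}-\mathcal{R}\|_{2\to2}^2$ are at most $$acg\,q^{-2LK}K!^P\prod_{p=1}^P\binom{q^{2\ell_p}+K-1}{K}-2ab\,q^{-2MK}K!^P\prod_{p=1}^P\binom{q^{2m_p}+K-1}{K}+ab\,q^{-2MK}K!^{2P}\prod_{p=1}^P\binom{q^{m_p}+K-1}{K}^2,$$ with the constants $$a=\prod_{p=1}^P\Bigl(1-\frac{K^2}{2q^{m_p}}\Bigr)^{-1},\quad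 b=\exp\Bigl(-\frac{K^2}{2q^M}\Bigr),\quad c=\Bigl(1-\frac{K^2}{2q^L}\Bigr)^{-1},\quad g=\prod_{p=1}^P\exp\Bigl(\frac{K^2}{2q^{m_p-\ell_p}}\Bigr).$$ -/

import Mathlib

open MeasureTheory TopologicalSpace
open scoped Matrix InnerProductSpace

noncomputable section

/-! ### Haar probability measure on the unitary group -/

section Haar

variable (n : Type*) [Fintype n] [DecidableEq n]

instance unitaryGroupCompactSpace : CompactSpace (Matrix.unitaryGroup n ℂ) := by
  have hc : IsCompact {f : n → n → ℂ | ∀ i j, f i j ∈ Metric.closedBall (0 : ℂ) 1} := by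
    have h := isCompact_univ_pi (X := fun _ : n => n → ℂ)
      (s := fun _ => Set.pi Set.univ fun _ : n => Metric.closedBall (0 : ℂ) 1)
      (fun _ => isCompact_univ_pi fun _ => isCompact_closedBall (0 : ℂ) 1)
    convert h using 1
    ext f
    simp
  have hcl : IsClosed ((Matrix.unitaryGroup n ℂ : Set (Matrix n n ℂ))) := by
    have : (Matrix.unitaryGroup n ℂ : Set (Matrix n n ℂ)) = {A | A * star A = 1} := by
      ext A
      exact Matrix.mem_unitaryGroup_iff
    rw [this]
    exact isClosed_eq (continuous_id.matrix_mul continuous_id.matrix_conjTranspose)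
      continuous_const
  refine isCompact_iff_compactSpace.mp (IsCompact.of_isClosed_subset hc hcl ?_)
  intro A hA i j
  simpa using entry_norm_bound_of_unitary hA i j

instance unitaryGroupMeasurableSpace : MeasurableSpace (Matrix.unitaryGroup n ℂ) := borel _

instance unitaryGroupBorelSpace : BorelSpace (Matrix.unitaryGroup n ℂ) := ⟨rfl⟩

/-- The Haar measure on the unitary group, normalised to total mass `1`. -/
def unitaryHaar : Measure (Matrix.unitaryGroup n ℂ) := Measure.haarMeasure ⊤

instance unitaryHaarIsProbabilityMeasure : IsProbabilityMeasure (unitaryHaar n) :=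
  ⟨by simpa [unitaryHaar] using
    Measure.haarMeasure_self (K₀ := (⊤ : PositiveCompacts (Matrix.unitaryGroup n ℂ)))⟩

end Haar

/-! ### Twirls

A finite set `S` labels qudits of local dimension `q`; the Hilbert space of these qudits is
`ℂ^(S → Fin q)`, with its computational basis labelled by `S → Fin q`, and the Hilbert space of
`K` copies of it has its computational basis labelled by `Fin K → S → Fin q`. -/

section Twirl

variable {S : Type*} [Fintype S] [DecidableEq S]

/-- The operator `U ⊗ 1` that acts as `U` on the qudits in `C` and trivially on the others. -/
def ampliate {q : ℕ} {C : Finset S} (U : Matrix (C → Fin q) (C → Fin q) ℂ) :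
    Matrix (S → Fin q) (S → Fin q) ℂ :=
  Matrix.of fun x y =>
    if ∀ s, s ∉ C → x s = y s then U (fun s => x s) (fun s => y s) else 0

/-- The `K`-fold tensor power `V ⊗ ⋯ ⊗ V`. -/
def tensorPower {n : Type*} (K : ℕ) (V : Matrix n n ℂ) :
    Matrix (Fin K → n) (Fin K → n) ℂ :=
  Matrix.of fun x y => ∏ k, V (x k) (y k)

/-- The operators on `K` copies of the qudits `S`. -/
abbrev CopyOp (K q : ℕ) (S : Type*) : Type _ :=
  Matrix (Fin K → S → Fin q) (Fin K → S → Fin q) ℂ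

/-- The conjugation of `X` by `(U ⊗ 1) ⊗ ⋯ ⊗ (U ⊗ 1)`, with `U` acting on the qudits in `C`. -/
def conjugate (K q : ℕ) (C : Finset S) (U : Matrix.unitaryGroup (C → Fin q) ℂ)
    (X : CopyOp K q S) : CopyOp K q S :=
  tensorPower K (ampliate (U : Matrix (C → Fin q) (C → Fin q) ℂ)) * X *
    (tensorPower K (ampliate (U : Matrix (C → Fin q) (C → Fin q) ℂ)))ᴴ

theorem continuous_conjugate (K q : ℕ) (C : Finset S) (X : CopyOp K q S)
    (i j : Fin K → S → Fin q) : Continuous fun U => conjugate K q C U X i j := by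
  have h : ∀ x y : Fin K → S → Fin q, Continuous fun U : Matrix.unitaryGroup (C → Fin q) ℂ =>
      tensorPower K (ampliate (U : Matrix (C → Fin q) (C → Fin q) ℂ)) x y := by
    intro x y
    simp only [tensorPower, ampliate, Matrix.of_apply]
    refine continuous_finsetProd _ fun k _ => ?_
    split_ifs
    · exact continuous_subtype_val.matrix_elem _ _
    · exact continuous_const
  simp only [conjugate, Matrix.mul_apply, Matrix.conjTranspose_apply]
  exact continuous_finsetSum _ fun k _ =>
    (continuous_finsetSum _ fun l _ => (h i l).mul continuous_const).mul (h j k).star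

theorem integrable_conjugate (K q : ℕ) (C : Finset S) (X : CopyOp K q S)
    (i j : Fin K → S → Fin q) :
    Integrable (fun U => conjugate K q C U X i j) (unitaryHaar (C → Fin q)) :=
  (continuous_conjugate K q C X i j).integrable_of_hasCompactSupport
    (HasCompactSupport.of_compactSpace _)

/-- The `K`-fold twirl `𝒯_C` over the subsystem consisting of the qudits in `C` (and acting as the
identity on the other qudits): `X ↦ ∫ (U ⊗ 1)^{⊗K} X ((U ⊗ 1)^{⊗K})† dU`, with `U` Haar distributed
on the unitary group of the subsystem. The integral is taken entry by entry. -/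
def twirl (K q : ℕ) (C : Finset S) : CopyOp K q S →ₗ[ℂ] CopyOp K q S where
  toFun X := Matrix.of fun i j => ∫ U, conjugate K q C U X i j ∂(unitaryHaar (C → Fin q))
  map_add' X Y := by
    ext i j
    simp only [Matrix.of_apply, Matrix.add_apply]
    rw [← integral_add (integrable_conjugate K q C X i j) (integrable_conjugate K q C Y i j)]
    simp [conjugate, Matrix.mul_add, Matrix.add_mul]
  map_smul' r X := by
    ext i j
    simp only [Matrix.of_apply, Matrix.smul_apply, RingHom.id_apply, smul_eq_mul]
    rw [← integral_const_mul]
    simp [conjugate]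

end Twirl

/-! ### The multipartite protocol -/

section Protocol

variable {P : ℕ}

/-- The qudits of one copy of the `P` parties, party `p` having `m p` qudits. -/
abbrev Qudit (m : Fin P → ℕ) : Type := (p : Fin P) × Fin (m p)

/-- All qudits of party `p`. -/
def partyQudits (m : Fin P → ℕ) (p : Fin P) : Finset (Qudit m) :=
  Finset.univ.filter fun s => s.1 = p

/-- The first `ℓ p` qudits of party `p`, for all parties `p` together. -/
def crossQudits (m ℓ : Fin P → ℕ) : Finset (Qudit m) :=
  Finset.univ.filter fun s => (s.2 : ℕ) < ℓ s.1

/-- `𝒫 = 𝒯_{A_1} ⊗ ⋯ ⊗ 𝒯_{A_P}`, as the composition of the commuting maps `𝒯_{A_p} ⊗ id`. -/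
def productTwirl (K q : ℕ) (m : Fin P → ℕ) : CopyOp K q (Qudit m) →ₗ[ℂ] CopyOp K q (Qudit m) :=
  (List.ofFn fun p => (twirl K q (partyQudits m p) : Module.End ℂ (CopyOp K q (Qudit m)))).prod

/-- The crosstwirl `𝒬`, over the first `ℓ p` qudits of all parties `p` jointly. -/
def crossTwirl (K q : ℕ) (m ℓ : Fin P → ℕ) :
    CopyOp K q (Qudit m) →ₗ[ℂ] CopyOp K q (Qudit m) :=
  twirl K q (crossQudits m ℓ)

/-- The full twirl `ℛ`, over all qudits of all parties jointly. -/
def fullTwirl (K q : ℕ) (m : Fin P → ℕ) : CopyOp K q (Qudit m) →ₗ[ℂ] CopyOp K q (Qudit m) :=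
  twirl K q Finset.univ

end Protocol

/-! ### Hilbert-Schmidt geometry and the subspace angle -/

open scoped Matrix.Norms.Frobenius

section Geometry

/-- The Hilbert-Schmidt inner product `⟪X, Y⟫ = tr (X† Y)`, whose norm is the Frobenius norm. -/
instance hilbertSchmidt (n : Type*) [Fintype n] : InnerProductSpace ℂ (Matrix n n ℂ) where
  inner X Y := (Xᴴ * Y).trace
  norm_sq_eq_re_inner X := by
    have h : ∀ i j : n, RCLike.re (star (X i j) * X i j) = ‖X i j‖ ^ 2 := by
      intro i j
      rw [Complex.star_def, Complex.conj_mul']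
      norm_cast
    rw [Matrix.frobenius_norm_def, ← Real.sqrt_eq_rpow, Real.sq_sqrt (by positivity)]
    simp only [Matrix.trace, Matrix.diag_apply, Matrix.mul_apply, Matrix.conjTranspose_apply,
      map_sum, h, Real.rpow_two]
    exact Finset.sum_comm
  conj_inner_symm X Y := by
    rw [starRingEnd_apply, ← Matrix.trace_conjTranspose, Matrix.conjTranspose_mul,
      Matrix.conjTranspose_conjTranspose]
  add_left X Y Z := by
    rw [Matrix.conjTranspose_add, Matrix.add_mul, Matrix.trace_add]
  smul_left X Y r := by
    rw [Matrix.conjTranspose_smul, Matrix.smul_mul, Matrix.trace_smul, smul_eq_mul,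
      starRingEnd_apply]

/-- The norm `‖Φ‖_{2→2} = sup_{X ≠ 0} ‖Φ X‖₂ / ‖X‖₂` of a linear map on matrices, where `‖·‖₂` is
the Frobenius norm (`X = 0` contributes the value `0`). -/
def norm22 {n : Type*} [Fintype n] (Φ : Matrix n n ℂ →ₗ[ℂ] Matrix n n ℂ) : ℝ :=
  ⨆ X : Matrix n n ℂ, ‖Φ X‖ / ‖X‖

theorem bddAbove_norm_div {E : Type*} [NormedAddCommGroup E] [NormedSpace ℂ E]
    [FiniteDimensional ℂ E] (Φ : E →ₗ[ℂ] E) :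
    BddAbove (Set.range fun x => ‖Φ x‖ / ‖x‖) := by
  refine ⟨‖LinearMap.toContinuousLinearMap Φ‖, ?_⟩
  rintro _ ⟨x, rfl⟩
  exact (LinearMap.toContinuousLinearMap Φ).ratio_le_opNorm x

/-- The supremum defining `‖Φ‖_{2→2}` is finite. -/
theorem bddAbove_norm22 {n : Type*} [Fintype n] (Φ : Matrix n n ℂ →ₗ[ℂ] Matrix n n ℂ) :
    BddAbove (Set.range fun X : Matrix n n ℂ => ‖Φ X‖ / ‖X‖) :=
  bddAbove_norm_div (E := Matrix n n ℂ) Φ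

/-- The subspace angle `c(U, V)` (the cosine of the Friedrichs angle) of two subspaces of matrices:
the supremum of `|⟪x, y⟫|` over `x` in `U ∩ (U ∩ V)ᗮ` and `y` in `V ∩ (U ∩ V)ᗮ` of norm at
most `1`, with respect to the Hilbert-Schmidt inner product. -/
def subspaceAngle {n : Type*} [Fintype n] (U V : Submodule ℂ (Matrix n n ℂ)) : ℝ :=
  sSup {r : ℝ | ∃ x ∈ U ⊓ (U ⊓ V)ᗮ, ∃ y ∈ V ⊓ (U ⊓ V)ᗮ,
    ‖x‖ ≤ 1 ∧ ‖y‖ ≤ 1 ∧ r = ‖(⟪x, y⟫_ℂ : ℂ)‖}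

end Geometry

/-! ### The constants of the bound -/

section Constants

variable {P : ℕ}

/-- `a = ∏_p (1 - K² / (2 q^{m_p}))⁻¹` -/
def constA (K q : ℕ) (m : Fin P → ℕ) : ℝ :=
  ∏ p, (1 - (K : ℝ) ^ 2 / (2 * (q : ℝ) ^ m p))⁻¹

/-- `b = exp (- K² / (2 q^M))` with `M = ∑_p m_p` -/
def constB (K q : ℕ) (m : Fin P → ℕ) : ℝ :=
  Real.exp (-((K : ℝ) ^ 2 / (2 * (q : ℝ) ^ ∑ p, m p)))

/-- `c = (1 - K² / (2 q^L))⁻¹` with `L = ∑_p ℓ_p` -/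
def constC (K q : ℕ) (ℓ : Fin P → ℕ) : ℝ :=
  (1 - (K : ℝ) ^ 2 / (2 * (q : ℝ) ^ ∑ p, ℓ p))⁻¹

/-- `g = ∏_p exp (K² / (2 q^{m_p - ℓ_p}))` -/
def constG (K q : ℕ) (m ℓ : Fin P → ℕ) : ℝ :=
  ∏ p, Real.exp ((K : ℝ) ^ 2 / (2 * (q : ℝ) ^ (m p - ℓ p)))

/-- The right-hand side of the bound. -/
def crosstwirlBound (K q : ℕ) (m ℓ : Fin P → ℕ) : ℝ :=
  constA K q m * constC K q ℓ * constG K q m ℓ * ((q : ℝ) ^ (2 * (∑ p, ℓ p) * K))⁻¹ *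
      (K.factorial : ℝ) ^ P * ∏ p, (((q ^ (2 * ℓ p) + K - 1).choose K : ℕ) : ℝ)
    - 2 * constA K q m * constB K q m * ((q : ℝ) ^ (2 * (∑ p, m p) * K))⁻¹ *
      (K.factorial : ℝ) ^ P * ∏ p, (((q ^ (2 * m p) + K - 1).choose K : ℕ) : ℝ)
    + constA K q m * constB K q m * ((q : ℝ) ^ (2 * (∑ p, m p) * K))⁻¹ *
      (K.factorial : ℝ) ^ (2 * P) * ∏ p, (((q ^ m p + K - 1).choose K : ℕ) : ℝ) ^ 2

end Constants

end

/-! ### Fixed words of permutations, and the birthday bound -/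

section Counting

open Finset

/-! Each twirl is the orthogonal projection onto the commutant of the operators `U ⊗ ⋯ ⊗ U`, and `im
ℛ` lies in `im 𝒫 ∩ im 𝒬`. By Pythagoras `‖(𝒬𝒫 - ℛ)X‖² = ‖𝒬Y‖² - ‖ℛY‖²` with `Y = 𝒫X`, so both claims
follow from `‖𝒬Y‖² - ‖ℛY‖² ≤ B ‖Y‖²` for `Y` in `im 𝒫` (`norm_crossTwirl_sq_sub_le`), where `B` is
the right-hand side.

Schur-Weyl duality (`exists_perm_expansion`) writes `Y = ∑ z_π π`, with one permutation of the
copies for each party. Permutation operators are almost orthogonal: the normalised overlap of two of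
them on one qudit is the proportion `fixRatio` of words fixed by their quotient. The comparison uses
three estimates, with `N = dim ℋ`. Lower Riesz bound: on columns whose `K` words are distinct in
every block, different permutations have disjoint supports; by the birthday bound most columns are
such. Hence `N ∑ |z_π|² ≤ a ‖Y‖²`, and likewise the constant `c` for `𝒬Y`. Upper bound on `‖𝒬Y‖²`:
pair `Y` with the expansion of `𝒬Y`, use Cauchy-Schwarz, and apply Schur's test to the qudits
outside the crosstwirl, which costs `g`. Lower bound on `‖ℛY‖²`: pair `Y` with a suitable
combination of the permutations common to all parties; Schur's test costs `b`.

`sum_sub_sum_norm_sq_le` compares the two quadratic forms in `z`. The remaining sums of powers of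
`fixRatio` over all tuples of permutations factor over the parties, and Burnside's lemma evaluates
each factor as a binomial coefficient. -/

theorem exists_perm_of_card_fiber_eq {α D : Type*} [Fintype α] [DecidableEq D] (f g : α → D)
    (h : ∀ d, #{a | f a = d} = #{a | g a = d}) : ∃ σ : Equiv.Perm α, ∀ a, f a = g (σ a) := by
  have e : ∀ d, Nonempty ({a // f a = d} ≃ {a // g a = d}) := fun d =>
    ⟨Fintype.equivOfCardEq (by rw [Fintype.card_subtype, Fintype.card_subtype, h d])⟩
  exact ⟨Equiv.ofFiberEquiv fun d => (e d).some, fun a =>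
    (Equiv.ofFiberEquiv_map (fun d => (e d).some) a).symm⟩

/-- Burnside's count of the multisets of size `K`. -/
theorem sum_card_comp_perm_eq (K : ℕ) (D : Type*) [Fintype D] [DecidableEq D] :
    ∑ τ : Equiv.Perm (Fin K), #{f : Fin K → D | f ∘ τ = f} =
      K.factorial * (Fintype.card D + K - 1).choose K := by
  classical
  -- The fibres of the map from words to multisets are the orbits of the permutations of the
  -- positions.
  let F : (Fin K → D) → Sym D K := fun f => ⟨univ.val.map f, by simp⟩
  have hcount : ∀ f d, Multiset.count d (F f : Multiset D) = #{a | f a = d} := by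
    intro f d
    change Multiset.count d (univ.val.map f) = _
    rw [Multiset.count_map, Finset.card_def, Finset.filter_val]
    simp only [eq_comm]
  have hF : Function.Surjective F := by
    intro s
    obtain ⟨l, hl⟩ := Quot.exists_rep (s : Multiset D)
    have hlen : l.length = K := by
      rw [← s.2]; change _ = Multiset.card (s : Multiset D); rw [← hl]; rfl
    subst hlen
    refine ⟨l.get, Sym.ext ?_⟩
    rw [← hl]
    change Multiset.map l.get (univ : Finset (Fin l.length)).val = _
    rw [Fin.univ_val_map]
    simp
  have hrel : ∀ f g, (MulAction.orbitRel (Equiv.Perm (Fin K))ᵈᵐᵃ (Fin K → D)) f g ↔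
      Setoid.ker F f g := by
    intro f g
    rw [MulAction.orbitRel_apply, MulAction.mem_orbit_iff, Setoid.ker_def]
    constructor
    · rintro ⟨σ, rfl⟩
      refine Sym.ext (Multiset.ext.2 fun d => ?_)
      rw [hcount, hcount]
      exact Finset.card_bij (fun a _ => DomMulAct.mk.symm σ a) (by simp [DomMulAct.smul_apply])
        (by simp) (fun b hb => ⟨(DomMulAct.mk.symm σ)⁻¹ b, by
          simpa [DomMulAct.smul_apply] using hb, by simp⟩)
    · intro h
      obtain ⟨σ, hσ⟩ := exists_perm_of_card_fiber_eq f g fun d => by rw [← hcount, ← hcount, h]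
      exact ⟨DomMulAct.mk σ, funext fun a => by simp [DomMulAct.smul_apply, hσ a]⟩
  let _ : Fintype (Equiv.Perm (Fin K))ᵈᵐᵃ := Fintype.ofEquiv _ DomMulAct.mk
  have hB := MulAction.sum_card_fixedBy_eq_card_orbits_mul_card_group
    (Equiv.Perm (Fin K))ᵈᵐᵃ (Fin K → D)
  have hq : Fintype.card (Quotient (MulAction.orbitRel (Equiv.Perm (Fin K))ᵈᵐᵃ (Fin K → D))) =
      (Fintype.card D + K - 1).choose K := by
    rw [← Sym.card_sym_eq_choose]
    exact Fintype.card_congr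
      ((Quotient.congrRight hrel).trans (Setoid.quotientKerEquivOfSurjective F hF))
  have hG : Fintype.card (Equiv.Perm (Fin K))ᵈᵐᵃ = K.factorial := by
    rw [← Fintype.card_congr (DomMulAct.mk (M := Equiv.Perm (Fin K)))]
    simp [Fintype.card_perm]
  rw [hq, hG] at hB
  rw [mul_comm, ← hB]
  refine Fintype.sum_equiv DomMulAct.mk _ _ fun τ => ?_
  rw [← Fintype.card_subtype]
  exact Fintype.card_congr (Equiv.refl _)

/-- The proportion of the words of length `K` that a permutation of the positions fixes. -/
noncomputable def fixRatio (q : ℕ) {K : ℕ} (τ : Equiv.Perm (Fin K)) : ℝ :=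
  (#{f : Fin K → Fin q | f ∘ τ = f} : ℝ) / (q : ℝ) ^ K

variable {q K : ℕ}

theorem fixRatio_nonneg (τ : Equiv.Perm (Fin K)) : 0 ≤ fixRatio q τ := by
  unfold fixRatio; positivity

theorem fixRatio_le_one (τ : Equiv.Perm (Fin K)) : fixRatio q τ ≤ 1 := by
  unfold fixRatio
  refine div_le_one_of_le₀ ?_ (by positivity)
  calc _ ≤ ((#(univ : Finset (Fin K → Fin q)) : ℕ) : ℝ) := by
        exact_mod_cast card_le_card (filter_subset _ _)
    _ = _ := by simp

theorem fixRatio_one (hq : 1 ≤ q) : fixRatio q (1 : Equiv.Perm (Fin K)) = 1 := by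
  have : (q : ℝ) ≠ 0 := by positivity
  simp [fixRatio, this]

theorem card_comp_perm_eq_pow (τ : Equiv.Perm (Fin K)) (n : ℕ) :
    #{f : Fin K → Fin n → Fin q | f ∘ τ = f} = #{f : Fin K → Fin q | f ∘ τ = f} ^ n := by
  have h : #(Fintype.piFinset fun _ : Fin n => ({f : Fin K → Fin q | f ∘ τ = f} : Finset _)) =
      #{f : Fin K → Fin q | f ∘ τ = f} ^ n := by simp
  rw [← h]
  refine card_bij (fun f _ s k => f k s) ?_ ?_ ?_
  · intro f hf
    simp only [mem_filter, mem_univ, true_and, Fintype.mem_piFinset, funext_iff,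
      Function.comp_apply] at hf ⊢
    exact fun s k => hf k s
  · intro f _ g _ hfg
    funext k s
    exact congrFun (congrFun hfg s) k
  · intro g hg
    refine ⟨fun k s => g s k, ?_, rfl⟩
    simp only [mem_filter, mem_univ, true_and, Fintype.mem_piFinset, funext_iff,
      Function.comp_apply] at hg ⊢
    exact fun k s => hg s k

theorem sum_fixRatio_pow (n : ℕ) : ∑ τ : Equiv.Perm (Fin K), fixRatio q τ ^ n =
    ((q : ℝ) ^ (n * K))⁻¹ * (K.factorial * ((q ^ n + K - 1).choose K : ℕ)) := by
  have h := sum_card_comp_perm_eq K (Fin n → Fin q)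
  simp only [card_comp_perm_eq_pow, Fintype.card_fun, Fintype.card_fin] at h
  simp only [fixRatio, div_pow, ← Finset.sum_div]
  rw [← Nat.cast_mul, ← h, div_eq_inv_mul, ← pow_mul, mul_comm n K]
  push_cast
  rfl

/-- By Burnside the sum equals `∏_{i<K} (1 + i/q^n)`, and `1 + x ≤ exp x`. This is the row sum
needed in Schur's test, hence the source of the exponentials in `b` and `g`. -/
theorem sum_fixRatio_pow_le (hq : 1 ≤ q) (n : ℕ) : ∑ τ : Equiv.Perm (Fin K), fixRatio q τ ^ n ≤
    Real.exp ((K : ℝ) ^ 2 / (2 * (q : ℝ) ^ n)) := by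
  have hd : 0 < (q : ℝ) ^ n := by positivity
  have hd1 : 1 ≤ q ^ n := Nat.one_le_pow _ _ hq
  have h1 : K.factorial * (q ^ n + K - 1).choose K = ∏ i ∈ range K, (q ^ n + i) := by
    obtain ⟨d, hd⟩ := Nat.exists_eq_add_of_le' hd1
    rw [hd, ← Nat.ascFactorial_eq_prod_range, Nat.ascFactorial_eq_factorial_mul_choose]
    congr 2
    omega
  rw [sum_fixRatio_pow, ← Nat.cast_mul, h1]
  push_cast
  calc ((q : ℝ) ^ (n * K))⁻¹ * ∏ i ∈ range K, ((q : ℝ) ^ n + i)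
      = ∏ i ∈ range K, ((i : ℝ) / (q : ℝ) ^ n + 1) := by
        have h2 : ((q : ℝ) ^ (n * K))⁻¹ = ∏ _i ∈ range K, ((q : ℝ) ^ n)⁻¹ := by
          rw [prod_const, card_range, pow_mul, inv_pow]
        rw [h2, ← prod_mul_distrib]
        refine prod_congr rfl fun i _ => ?_
        field_simp
        ring
    _ ≤ ∏ i ∈ range K, Real.exp ((i : ℝ) / (q : ℝ) ^ n) :=
        prod_le_prod (fun i _ => by positivity) fun i _ => Real.add_one_le_exp _
    _ = Real.exp (∑ i ∈ range K, (i : ℝ) / (q : ℝ) ^ n) := (Real.exp_sum _ _).symm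
    _ ≤ _ := by
        refine Real.exp_le_exp.2 ?_
        rw [← Finset.sum_div, div_le_div_iff₀ hd (by positivity)]
        have h2 : (∑ i ∈ range K, (i : ℝ)) * 2 ≤ (K : ℝ) ^ 2 := by
          have := Finset.sum_range_id_mul_two K
          calc (∑ i ∈ range K, (i : ℝ)) * 2 = ((∑ i ∈ range K, i) * 2 : ℕ) := by push_cast; rfl
            _ ≤ ((K ^ 2 : ℕ) : ℝ) := by
              rw [this, sq]
              exact_mod_cast Nat.mul_le_mul_left _ (Nat.sub_le _ _)
            _ = _ := by push_cast; rfl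
        nlinarith

/-- The birthday bound: the right side is the probability that `K` independent uniform draws from
`d` values are distinct. The induction needs the sharper `k(k-1)` in place of `k²`. -/
theorem one_sub_le_descFactorial_div {d : ℕ} (hd : 1 ≤ d) (hK : K ≤ d) :
    1 - (K : ℝ) ^ 2 / (2 * d) ≤ (d.descFactorial K : ℝ) / (d : ℝ) ^ K := by
  have hd0 : (0 : ℝ) < d := by exact_mod_cast hd
  have key : ∀ k ≤ d, 1 - (k : ℝ) * (k - 1) / (2 * d) ≤ (d.descFactorial k : ℝ) / (d : ℝ) ^ k := by
    intro k
    induction k with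
    | zero => simp
    | succ k ih =>
      intro hk
      have hk' : (k : ℝ) ≤ d := by exact_mod_cast (Nat.le_succ k).trans hk
      have hv : (d.descFactorial k : ℝ) / (d : ℝ) ^ k ≤ 1 :=
        div_le_one_of_le₀ (by exact_mod_cast Nat.descFactorial_le_pow d k) (by positivity)
      have hu : 0 ≤ (k : ℝ) / d := by positivity
      have h1 : (d.descFactorial (k + 1) : ℝ) / (d : ℝ) ^ (k + 1) =
          (1 - k / d) * ((d.descFactorial k : ℝ) / (d : ℝ) ^ k) := by
        rw [Nat.descFactorial_succ, Nat.cast_mul, Nat.cast_sub ((Nat.le_succ k).trans hk)]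
        field_simp
        ring
      have h2 : ((k + 1 : ℕ) : ℝ) * ((k + 1 : ℕ) - 1) / (2 * d) =
          k * (k - 1) / (2 * d) + k / d := by
        push_cast
        field_simp
        ring
      rw [h1, h2]
      nlinarith [ih ((Nat.le_succ k).trans hk), mul_le_mul_of_nonneg_left hv hu]
  refine le_trans ?_ (key K hK)
  have : (K : ℝ) * (K - 1) / (2 * d) ≤ (K : ℝ) ^ 2 / (2 * d) := by
    gcongr
    nlinarith [(Nat.cast_nonneg K : (0 : ℝ) ≤ K)]
  linarith

end Counting

/-! ### Independence of disjoint sets of qudits -/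

section Independence

open Finset

variable {S : Type*} [Fintype S] [DecidableEq S] {K q : ℕ}

theorem sum_prod_columns {R : Type*} [CommSemiring R] (f : S → (Fin K → Fin q) → R) :
    ∑ x : Fin K → S → Fin q, ∏ s, f s (fun k => x k s) = ∏ s, ∑ v, f s v := by
  rw [Fintype.prod_sum]
  exact Fintype.sum_equiv (Equiv.piComm _) _ _ fun x => rfl

theorem card_copies : (Fintype.card (Fin K → S → Fin q) : ℝ) = (q : ℝ) ^ (Fintype.card S * K) := by
  simp [pow_mul]

/-- Functions of disjoint sets of coordinates are independent. -/
theorem sum_mul_sum_of_disjoint_coords {R : Type*} [CommSemiring R] (A : Finset S)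
    (f g : (Fin K → S → Fin q) → R)
    (hf : ∀ x x', (∀ k, ∀ s ∈ A, x k s = x' k s) → f x = f x')
    (hg : ∀ x x', (∀ k, ∀ s ∉ A, x k s = x' k s) → g x = g x') :
    (Fintype.card (Fin K → S → Fin q) : R) * ∑ x, f x * g x = (∑ x, f x) * ∑ x, g x := by
  let mix : (Fin K → S → Fin q) → (Fin K → S → Fin q) → (Fin K → S → Fin q) :=
    fun x y k s => if s ∈ A then x k s else y k s
  -- Exchanging the coordinates outside `A` between the two members of a pair is an involution that
  -- turns `f x * g x` into `f x * g y`.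
  let e : (Fin K → S → Fin q) × (Fin K → S → Fin q) ≃
      (Fin K → S → Fin q) × (Fin K → S → Fin q) :=
    { toFun := fun p => (mix p.1 p.2, mix p.2 p.1)
      invFun := fun p => (mix p.1 p.2, mix p.2 p.1)
      left_inv := fun p => by
        ext k s <;> by_cases h : s ∈ A <;> simp [mix, h]
      right_inv := fun p => by
        ext k s <;> by_cases h : s ∈ A <;> simp [mix, h] }
  have h1 : (∑ x, f x) * ∑ x, g x =
      ∑ p : (Fin K → S → Fin q) × (Fin K → S → Fin q), f p.1 * g p.2 := by
    rw [Fintype.sum_prod_type, sum_mul_sum]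
  have h2 : (Fintype.card (Fin K → S → Fin q) : R) * ∑ x, f x * g x =
      ∑ p : (Fin K → S → Fin q) × (Fin K → S → Fin q), f p.1 * g p.1 := by
    rw [Fintype.sum_prod_type_right]
    simp
  rw [h1, h2]
  refine Fintype.sum_equiv e _ _ fun p => ?_
  refine congrArg₂ _ (hf _ _ fun k s hs => ?_) (hg _ _ fun k s hs => ?_)
  · simp [e, mix, hs]
  · simp [e, mix, hs]

/-- The condition separates over the qudits: column `s` of `y` must be fixed by `π' s * (π s)⁻¹`
when `s ∈ A`, and is free otherwise. -/
theorem card_agree (hq : 1 ≤ q) (A : Finset S) (π π' : S → Equiv.Perm (Fin K)) :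
    (#{y : Fin K → S → Fin q | ∀ k, ∀ s ∈ A, y (π s k) s = y (π' s k) s} : ℝ) =
      (q : ℝ) ^ (Fintype.card S * K) * ∏ s ∈ A, fixRatio q (π' s * (π s)⁻¹) := by
  classical
  have hq0 : (q : ℝ) ≠ 0 := by positivity
  have h := sum_prod_columns (q := q) (K := K) (fun s v =>
    if s ∈ A → v ∘ (π' s * (π s)⁻¹) = v then (1 : ℝ) else 0)
  rw [card_eq_sum_ones, sum_filter]
  push_cast
  trans ∏ s : S, (q : ℝ) ^ K * (if s ∈ A then fixRatio q (π' s * (π s)⁻¹) else 1)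
  · rw [← Fintype.prod_congr _ _ fun s => ?_, ← h]
    · refine sum_congr rfl fun y _ => ?_
      rw [prod_ite_zero]
      simp only [prod_const_one, mem_univ, true_imp_iff]
      refine if_congr ?_ rfl rfl
      constructor
      · intro hy s hs
        funext k
        simpa using (hy ((π s)⁻¹ k) s hs).symm
      · intro hy k s hs
        simpa using (congrFun (hy s hs) (π s k)).symm
    · by_cases hs : s ∈ A
      · simp only [hs, fixRatio, if_true, true_imp_iff, Finset.sum_boole]
        field_simp
      · simp [hs]
  · rw [prod_mul_distrib, prod_const, card_univ, ← pow_mul, mul_comm K, prod_ite_mem, univ_inter]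

theorem card_injective_on (hq : 1 ≤ q) (C : Finset S) (hK : K ≤ q ^ #C) :
    (q : ℝ) ^ (Fintype.card S * K) * (1 - (K : ℝ) ^ 2 / (2 * (q : ℝ) ^ #C)) ≤
      (#{y : Fin K → S → Fin q | Function.Injective fun k => fun s : C => y k s} : ℝ) := by
  classical
  let e : (Fin K → S → Fin q) ≃
      (Fin K → ({s // s ∈ C} → Fin q)) × (Fin K → ({s // s ∉ C} → Fin q)) :=
    (Equiv.arrowCongr (Equiv.refl _) (Equiv.piEquivPiSubtypeProd (· ∈ C) _)).trans
      (Equiv.arrowProdEquivProdArrow _ _ _)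
  have hcard : #{y : Fin K → S → Fin q | Function.Injective fun k => fun s : C => y k s} =
      (q ^ #C).descFactorial K * (q ^ (Fintype.card S - #C)) ^ K := by
    rw [← Fintype.card_subtype]
    rw [Fintype.card_congr (e.subtypeEquiv (p := fun y => Function.Injective
      fun k => fun s : C => y k s) (q := fun p => Function.Injective p.1) fun y => Iff.rfl)]
    rw [Fintype.card_congr (Equiv.prodSubtypeFstEquivSubtypeProd
      (p := fun f : Fin K → ({s // s ∈ C} → Fin q) => Function.Injective f))]
    rw [Fintype.card_prod, Fintype.card_congr (Equiv.subtypeInjectiveEquivEmbedding _ _),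
      Fintype.card_embedding_eq]
    simp [Fintype.card_subtype_compl]
  have h := one_sub_le_descFactorial_div (Nat.one_le_pow #C q hq) hK
  rw [hcard]
  push_cast at h ⊢
  have hq0 : (0 : ℝ) < q := by positivity
  rw [le_div_iff₀ (by positivity)] at h
  have h3 : (q : ℝ) ^ (Fintype.card S * K) = ((q : ℝ) ^ #C) ^ K *
      ((q : ℝ) ^ (Fintype.card S - #C)) ^ K := by
    rw [← mul_pow, ← pow_add, Nat.add_sub_cancel' (card_le_univ C), pow_mul]
  rw [h3]
  nlinarith [mul_le_mul_of_nonneg_right h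
    (by positivity : (0 : ℝ) ≤ ((q : ℝ) ^ (Fintype.card S - #C)) ^ K)]

end Independence

/-! ### Commutants and twirls -/

section OnCopies

variable {S : Type*} [Fintype S] [DecidableEq S] {K q : ℕ} {C : Finset S}

theorem tensorPower_mul {n : Type*} [Fintype n] [DecidableEq n] (V W : Matrix n n ℂ) :
    tensorPower K (V * W) = tensorPower K V * tensorPower K W := by
  ext x y
  simp only [tensorPower, Matrix.of_apply, Matrix.mul_apply, Fintype.prod_sum,
    Finset.prod_mul_distrib]

theorem tensorPower_one {n : Type*} [Fintype n] [DecidableEq n] :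
    tensorPower K (1 : Matrix n n ℂ) = 1 := by
  ext x y
  simp only [tensorPower, Matrix.of_apply, Matrix.one_apply, Finset.prod_ite_zero,
    Finset.prod_const_one, Finset.mem_univ, true_imp_iff, funext_iff]

theorem tensorPower_conjTranspose {n : Type*} (V : Matrix n n ℂ) :
    (tensorPower K V)ᴴ = tensorPower K Vᴴ := by
  ext x y
  simp [tensorPower, Matrix.conjTranspose_apply]

theorem ampliate_eq_submatrix (A : Matrix (C → Fin q) (C → Fin q) ℂ) :
    ampliate (S := S) A = (Matrix.kroneckerMap (· * ·) A
      (1 : Matrix ({s // s ∉ C} → Fin q) ({s // s ∉ C} → Fin q) ℂ)).submatrix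
        (Equiv.piEquivPiSubtypeProd (· ∈ C) fun _ => Fin q)
        (Equiv.piEquivPiSubtypeProd (· ∈ C) fun _ => Fin q) := by
  ext x y
  simp only [ampliate, Matrix.of_apply, Matrix.submatrix_apply, Matrix.kroneckerMap_apply,
    Equiv.piEquivPiSubtypeProd, Equiv.coe_fn_mk, Matrix.one_apply, mul_ite, mul_one, mul_zero,
    funext_iff, Subtype.forall]

theorem ampliate_mul (A B : Matrix (C → Fin q) (C → Fin q) ℂ) :
    ampliate (S := S) (A * B) = ampliate A * ampliate B := by
  simp only [ampliate_eq_submatrix]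
  rw [Matrix.submatrix_mul_equiv, ← Matrix.mul_kronecker_mul, one_mul]

theorem ampliate_one : ampliate (S := S) (1 : Matrix (C → Fin q) (C → Fin q) ℂ) = 1 := by
  rw [ampliate_eq_submatrix, Matrix.one_kronecker_one, Matrix.submatrix_one_equiv]

theorem ampliate_conjTranspose (A : Matrix (C → Fin q) (C → Fin q) ℂ) :
    (ampliate (S := S) A)ᴴ = ampliate Aᴴ := by
  ext x y
  simp only [ampliate, Matrix.of_apply, Matrix.conjTranspose_apply, eq_comm (a := y _)]
  split_ifs <;> simp

/-- The operator `A ⊗ 1` on every one of the `K` copies. -/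
def onCopies (K : ℕ) (A : Matrix (C → Fin q) (C → Fin q) ℂ) : CopyOp K q S :=
  tensorPower K (ampliate A)

theorem onCopies_mul (A B : Matrix (C → Fin q) (C → Fin q) ℂ) :
    onCopies (S := S) K (A * B) = onCopies K A * onCopies K B := by
  rw [onCopies, ampliate_mul, tensorPower_mul]; rfl

theorem onCopies_one : onCopies (S := S) K (1 : Matrix (C → Fin q) (C → Fin q) ℂ) = 1 := by
  rw [onCopies, ampliate_one, tensorPower_one]

theorem onCopies_conjTranspose (A : Matrix (C → Fin q) (C → Fin q) ℂ) :
    (onCopies (S := S) K A)ᴴ = onCopies K Aᴴ := by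
  rw [onCopies, tensorPower_conjTranspose, ampliate_conjTranspose]; rfl

theorem onCopies_conjTranspose_mul_self (U : Matrix.unitaryGroup (C → Fin q) ℂ) :
    (onCopies (S := S) K (U : Matrix (C → Fin q) (C → Fin q) ℂ))ᴴ * onCopies K U.1 = 1 := by
  rw [onCopies_conjTranspose, ← onCopies_mul, ← Matrix.star_eq_conjTranspose,
    Matrix.UnitaryGroup.star_mul_self, onCopies_one]

theorem onCopies_mul_conjTranspose_self (U : Matrix.unitaryGroup (C → Fin q) ℂ) :
    onCopies (S := S) K U.1 * (onCopies K U.1)ᴴ = 1 :=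
  mul_eq_one_comm.1 (onCopies_conjTranspose_mul_self U)

theorem conjugate_eq (U : Matrix.unitaryGroup (C → Fin q) ℂ) (X : CopyOp K q S) :
    conjugate K q C U X = onCopies K U.1 * X * (onCopies K U.1)ᴴ := rfl

theorem ampliate_mul_of_disjoint {C' : Finset S} (h : Disjoint C C')
    (A : Matrix (C → Fin q) (C → Fin q) ℂ) (B : Matrix (C' → Fin q) (C' → Fin q) ℂ)
    (x y : S → Fin q) :
    (ampliate A * ampliate B) x y = if ∀ s, s ∉ C → s ∉ C' → x s = y s then
      A (fun s => x s) (fun s => y s) * B (fun s => x s) (fun s => y s) else 0 := by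
  have hd : ∀ s, s ∈ C → s ∉ C' := fun s hs => Finset.disjoint_left.1 h hs
  -- Only one intermediate word contributes: it must follow `x` on `C'` and `y` elsewhere.
  rw [Matrix.mul_apply, Finset.sum_eq_single (fun s => if s ∈ C' then x s else y s)]
  · have h1 : (fun s : C => if (s : S) ∈ C' then x s else y s) = fun s : C => y s := by
      funext s; simp [hd s s.2]
    have h2 : (fun s : C' => if (s : S) ∈ C' then x s else y s) = fun s : C' => x s := by
      funext s; simp
    have h3 : (∀ s, s ∉ C → x s = if s ∈ C' then x s else y s) ↔
        ∀ s, s ∉ C → s ∉ C' → x s = y s := by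
      refine forall₂_congr fun s hs => ?_
      by_cases hs' : s ∈ C' <;> simp [hs']
    simp only [ampliate, Matrix.of_apply, h1, h2, h3]
    rw [if_pos (show ∀ s, s ∉ C' → (if s ∈ C' then x s else y s) = y s from
      fun s hs => by simp [hs])]
    split_ifs <;> simp
  · intro w _ hw
    simp only [ampliate, Matrix.of_apply]
    split_ifs with h1 h2
    · refine absurd (funext fun s => ?_) hw
      by_cases hs : s ∈ C'
      · simp [hs, h1 s fun hC => hd s hC hs]
      · simp [hs, h2 s hs]
    all_goals simp
  · simp

theorem onCopies_comm_of_disjoint {C' : Finset S} (h : Disjoint C C')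
    (A : Matrix (C → Fin q) (C → Fin q) ℂ) (B : Matrix (C' → Fin q) (C' → Fin q) ℂ) :
    onCopies (S := S) K A * onCopies K B = onCopies K B * onCopies K A := by
  rw [onCopies, onCopies, ← tensorPower_mul, ← tensorPower_mul]
  congr 1
  ext x y
  rw [ampliate_mul_of_disjoint h, ampliate_mul_of_disjoint h.symm]
  refine if_congr ⟨fun h s h1 h2 => h s h2 h1, fun h s h1 h2 => h s h2 h1⟩ (mul_comm _ _) rfl

/-- The operators that commute with `U ⊗ ⋯ ⊗ U` for every unitary `U` on the qudits in `C`. -/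
def fixedOps (K q : ℕ) (C : Finset S) : Submodule ℂ (CopyOp K q S) where
  carrier := {X | ∀ U : Matrix.unitaryGroup (C → Fin q) ℂ,
    onCopies K U.1 * X = X * onCopies K U.1}
  add_mem' := fun {X Y} hX hY U => by
    rw [Matrix.mul_add, Matrix.add_mul, hX U, hY U]
  zero_mem' := fun U => by simp
  smul_mem' := fun r X hX U => by
    rw [Matrix.mul_smul, Matrix.smul_mul, hX U]

theorem mem_fixedOps {X : CopyOp K q S} : X ∈ fixedOps K q C ↔
    ∀ U : Matrix.unitaryGroup (C → Fin q) ℂ, onCopies K U.1 * X = X * onCopies K U.1 := Iff.rfl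

theorem conjugate_eq_self_iff (U : Matrix.unitaryGroup (C → Fin q) ℂ) (X : CopyOp K q S) :
    conjugate K q C U X = X ↔ onCopies K U.1 * X = X * onCopies K U.1 := by
  rw [conjugate_eq]
  constructor
  · intro h
    calc onCopies K U.1 * X = onCopies K U.1 * X * ((onCopies K U.1)ᴴ * onCopies K U.1) := by
          rw [onCopies_conjTranspose_mul_self, mul_one]
      _ = X * onCopies K U.1 := by rw [← mul_assoc, h]
  · intro h
    rw [h, mul_assoc, onCopies_mul_conjTranspose_self, mul_one]

theorem fixedOps_univ_le : fixedOps K q (Finset.univ : Finset S) ≤ fixedOps K q C := by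
  intro X hX U
  let e : (↥(Finset.univ : Finset S) → Fin q) ≃ (S → Fin q) :=
    Equiv.arrowCongr (Equiv.subtypeUnivEquiv Finset.mem_univ) (Equiv.refl _)
  let W : Matrix (↥(Finset.univ : Finset S) → Fin q) (↥(Finset.univ : Finset S) → Fin q) ℂ :=
    (ampliate (S := S) U.1).submatrix e e
  have hW : W ∈ Matrix.unitaryGroup (↥(Finset.univ : Finset S) → Fin q) ℂ := by
    rw [Matrix.mem_unitaryGroup_iff, Matrix.star_eq_conjTranspose]
    change (ampliate (S := S) U.1).submatrix e e * ((ampliate (S := S) U.1).submatrix e e)ᴴ = 1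
    rw [Matrix.conjTranspose_submatrix, Matrix.submatrix_mul_equiv, ampliate_conjTranspose,
      ← ampliate_mul, ← Matrix.star_eq_conjTranspose, Unitary.mul_star_self_of_mem U.2,
      ampliate_one, Matrix.submatrix_one_equiv]
  have h : onCopies (S := S) K W = onCopies K U.1 := by
    rw [onCopies, onCopies]
    congr 1
    ext x y
    simp only [ampliate, Matrix.of_apply, Finset.mem_univ, not_true_eq_false, false_imp_iff,
      implies_true, if_true, W, Matrix.submatrix_apply]
    rfl
  have := hX ⟨W, hW⟩
  rwa [h] at this

theorem mul_twirl_mul_apply (A B X : CopyOp K q S) (i j : Fin K → S → Fin q) :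
    (A * twirl K q C X * B) i j =
      ∫ U, (A * conjugate K q C U X * B) i j ∂(unitaryHaar (C → Fin q)) := by
  have h : ∀ Z : CopyOp K q S, (A * Z * B) i j = ∑ l, ∑ k, A i k * Z k l * B l j := by
    intro Z
    simp only [Matrix.mul_apply, Finset.sum_mul]
  simp only [h]
  rw [integral_finsetSum]
  · refine Finset.sum_congr rfl fun l _ => ?_
    rw [integral_finsetSum]
    · refine Finset.sum_congr rfl fun k _ => ?_
      rw [integral_mul_const, integral_const_mul]
      rfl
    · exact fun k _ => ((integrable_conjugate K q C X k l).const_mul _).mul_const _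
  · exact fun l _ => integrable_finsetSum _ fun k _ =>
      ((integrable_conjugate K q C X k l).const_mul _).mul_const _

theorem mul_twirl_apply (A X : CopyOp K q S) (i j : Fin K → S → Fin q) :
    (A * twirl K q C X) i j =
      ∫ U, (A * conjugate K q C U X) i j ∂(unitaryHaar (C → Fin q)) := by
  simpa using mul_twirl_mul_apply A 1 X i j

theorem conjugate_conjugate (U V : Matrix.unitaryGroup (C → Fin q) ℂ) (X : CopyOp K q S) :
    conjugate K q C V (conjugate K q C U X) = conjugate K q C (V * U) X := by
  simp only [conjugate_eq, Matrix.UnitaryGroup.mul_val, onCopies_mul, Matrix.conjTranspose_mul,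
    mul_assoc]

instance unitaryHaar_isMulLeftInvariant (n : Type*) [Fintype n] [DecidableEq n] :
    (unitaryHaar n).IsMulLeftInvariant := by
  unfold unitaryHaar; infer_instance

theorem twirl_mem_fixedOps (X : CopyOp K q S) : twirl K q C X ∈ fixedOps K q C := by
  intro V
  rw [← conjugate_eq_self_iff]
  ext i j
  rw [conjugate_eq, mul_twirl_mul_apply]
  simp only [← conjugate_eq, conjugate_conjugate]
  exact integral_mul_left_eq_self (fun U => conjugate K q C U X i j) V

/-- A twirl preserves commutation with any `W` that commutes with the twirling unitaries. Thus the
twirl of one party does not destroy the invariance obtained from another. -/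
theorem twirl_mem_of_comm {W X : CopyOp K q S} (hX : W * X = X * W)
    (hW : ∀ U : Matrix.unitaryGroup (C → Fin q) ℂ, onCopies K U.1 * W = W * onCopies K U.1) :
    W * twirl K q C X = twirl K q C X * W := by
  have hW' : ∀ U : Matrix.unitaryGroup (C → Fin q) ℂ,
      (onCopies K U.1)ᴴ * W = W * (onCopies K U.1)ᴴ := by
    intro U
    have := hW U⁻¹
    rwa [onCopies_conjTranspose]
  ext i j
  rw [mul_twirl_apply]
  have := mul_twirl_mul_apply (C := C) 1 W X i j
  rw [one_mul] at this
  rw [this]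
  refine integral_congr_ae (.of_forall fun U => ?_)
  beta_reduce
  rw [one_mul, conjugate_eq, mul_assoc _ _ W, hW', ← mul_assoc, ← mul_assoc, ← mul_assoc, ← hW,
    mul_assoc _ X W, ← hX, mul_assoc _ W X]

/-- By cyclicity of the trace the unitaries move onto `Yᴴ`, with which they commute, and cancel; so
the integrand is constant and the measure has mass one. -/
theorem trace_conjTranspose_mul_twirl (X Y : CopyOp K q S) (hY : Y ∈ fixedOps K q C) :
    (Yᴴ * twirl K q C X).trace = (Yᴴ * X).trace := by
  have h : ∀ U, (Yᴴ * conjugate K q C U X).trace = (Yᴴ * X).trace := by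
    intro U
    have hU := congrArg Matrix.conjTranspose (hY U⁻¹)
    rw [Matrix.conjTranspose_mul, Matrix.conjTranspose_mul, onCopies_conjTranspose] at hU
    have hs : ((U⁻¹ : Matrix.unitaryGroup (C → Fin q) ℂ) : Matrix _ _ ℂ)ᴴ = U.1 :=
      Matrix.conjTranspose_conjTranspose U.1
    rw [hs] at hU
    rw [conjugate_eq, ← mul_assoc, Matrix.trace_mul_comm, ← mul_assoc,
      ← mul_assoc, mul_assoc _ Yᴴ, hU, ← mul_assoc, onCopies_conjTranspose_mul_self, one_mul]
  simp only [Matrix.trace, Matrix.diag_apply, mul_twirl_apply] at h ⊢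
  rw [← integral_finsetSum]
  · simp only [h]
    simp
  · intro i _
    simp only [Matrix.mul_apply]
    exact integrable_finsetSum _ fun k _ => (integrable_conjugate K q C X k i).const_mul _

end OnCopies

/-! ### Orthogonal projections and the reduction to a difference of norms -/

section Projection

/-- `T` is the orthogonal projection onto `V`. -/
structure IsOrthogonalProjectionOnto {E : Type*} [NormedAddCommGroup E] [InnerProductSpace ℂ E]
    (T : E →ₗ[ℂ] E) (V : Submodule ℂ E) : Prop where
  mem : ∀ x, T x ∈ V
  inner_eq : ∀ x, ∀ y ∈ V, ⟪y, T x⟫_ℂ = ⟪y, x⟫_ℂ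

namespace IsOrthogonalProjectionOnto

variable {E : Type*} [NormedAddCommGroup E] [InnerProductSpace ℂ E]
  {T P Q R : E →ₗ[ℂ] E} {V VP VQ VR : Submodule ℂ E}

theorem eq_of_inner (hT : IsOrthogonalProjectionOnto T V) {x z : E} (hz : z ∈ V)
    (h : ∀ y ∈ V, ⟪y, z⟫_ℂ = ⟪y, x⟫_ℂ) : T x = z := by
  rw [← sub_eq_zero, ← inner_self_eq_zero (𝕜 := ℂ)]
  have hm := V.sub_mem (hT.mem x) hz
  rw [inner_sub_right, hT.inner_eq x _ hm, h _ hm, sub_self]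

theorem apply_of_mem (hT : IsOrthogonalProjectionOnto T V) {x : E} (hx : x ∈ V) : T x = x :=
  hT.eq_of_inner hx fun _ _ => rfl

theorem range_eq (hT : IsOrthogonalProjectionOnto T V) : LinearMap.range T = V := by
  ext x
  constructor
  · rintro ⟨y, rfl⟩
    exact hT.mem y
  · exact fun hx => ⟨x, hT.apply_of_mem hx⟩

theorem inner_self_apply (hT : IsOrthogonalProjectionOnto T V) (x : E) :
    ⟪T x, x⟫_ℂ = (‖T x‖ : ℂ) ^ 2 := by
  rw [← hT.inner_eq x _ (hT.mem x), inner_self_eq_norm_sq_to_K]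
  rfl

theorem norm_apply_le (hT : IsOrthogonalProjectionOnto T V) (x : E) : ‖T x‖ ≤ ‖x‖ := by
  have h1 : ‖⟪T x, x⟫_ℂ‖ ≤ ‖T x‖ * ‖x‖ := norm_inner_le_norm _ _
  rw [hT.inner_self_apply] at h1
  simp only [norm_pow, Complex.norm_real, norm_norm] at h1
  nlinarith [norm_nonneg (T x), norm_nonneg x]

/-- Since `VR` lies in `VP` and `VQ`, `R X = R (P X)` is the projection of `Q (P X)` onto `VR`, and
Pythagoras turns the norm of the difference into a difference of squared norms. -/
theorem norm_comp_sub_sq_le (hP : IsOrthogonalProjectionOnto P VP)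
    (hQ : IsOrthogonalProjectionOnto Q VQ) (hR : IsOrthogonalProjectionOnto R VR)
    (hRP : VR ≤ VP) (hRQ : VR ≤ VQ) {B : ℝ} (hB : 0 ≤ B)
    (h : ∀ Y ∈ VP, ‖Q Y‖ ^ 2 - ‖R Y‖ ^ 2 ≤ B * ‖Y‖ ^ 2) (X : E) :
    ‖Q (P X) - R X‖ ^ 2 ≤ B * ‖X‖ ^ 2 := by
  have hRX : R X = R (P X) := hR.eq_of_inner (hR.mem _) fun y hy => by
    rw [hR.inner_eq _ _ hy, hP.inner_eq _ _ (hRP hy)]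
  have h1 : ⟪Q (P X), R (P X)⟫_ℂ = (‖R (P X)‖ : ℂ) ^ 2 := by
    rw [← inner_conj_symm, hQ.inner_eq _ _ (hRQ (hR.mem _)), hR.inner_self_apply, map_pow,
      Complex.conj_ofReal]
  have h2 : ‖Q (P X) - R X‖ ^ 2 = ‖Q (P X)‖ ^ 2 - ‖R (P X)‖ ^ 2 := by
    rw [hRX, norm_sub_sq (𝕜 := ℂ), h1, ← Complex.ofReal_pow]
    simp only [RCLike.re_to_complex, Complex.ofReal_re]
    ring
  rw [h2]
  refine (h _ (hP.mem X)).trans (mul_le_mul_of_nonneg_left ?_ hB)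
  exact pow_le_pow_left₀ (norm_nonneg _) (hP.norm_apply_le X) 2

/-- For `x` in `VP` orthogonal to `VP ⊓ VQ`, `P x = x` and `R x = 0`, so the assumed estimate at `x`
bounds `Q x`, and `⟪y, x⟫ = ⟪y, Q x⟫`. -/
theorem norm_inner_le_of_norm_comp_sub_le (hP : IsOrthogonalProjectionOnto P VP)
    (hQ : IsOrthogonalProjectionOnto Q VQ) (hR : IsOrthogonalProjectionOnto R VR)
    (hRP : VR ≤ VP) (hRQ : VR ≤ VQ) {c : ℝ} (hc : 0 ≤ c)
    (h : ∀ X, ‖Q (P X) - R X‖ ≤ c * ‖X‖) {x y : E} (hx : x ∈ VP ⊓ (VP ⊓ VQ)ᗮ) (hy : y ∈ VQ)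
    (hx1 : ‖x‖ ≤ 1) (hy1 : ‖y‖ ≤ 1) : ‖⟪x, y⟫_ℂ‖ ≤ c := by
  have hRx : R x = 0 := hR.eq_of_inner VR.zero_mem fun z hz => by
    rw [inner_zero_right, (Submodule.mem_orthogonal _ _).1 hx.2 z ⟨hRP hz, hRQ hz⟩]
  have h1 := h x
  rw [hP.apply_of_mem hx.1, hRx, sub_zero] at h1
  rw [norm_inner_symm, ← hQ.inner_eq x y hy]
  calc ‖⟪y, Q x⟫_ℂ‖ ≤ ‖y‖ * ‖Q x‖ := norm_inner_le_norm _ _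
    _ ≤ 1 * (c * 1) := mul_le_mul hy1 (h1.trans (mul_le_mul_of_nonneg_left hx1 hc))
        (norm_nonneg _) zero_le_one
    _ = c := by ring

end IsOrthogonalProjectionOnto

open scoped Matrix.Norms.Frobenius

theorem inner_eq_trace {n : Type*} [Fintype n] (X Y : Matrix n n ℂ) :
    ⟪X, Y⟫_ℂ = (Xᴴ * Y).trace := rfl

theorem isOrthogonalProjectionOnto_twirl {S : Type*} [Fintype S] [DecidableEq S] (K q : ℕ)
    (C : Finset S) : IsOrthogonalProjectionOnto (twirl K q C) (fixedOps K q C) :=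
  ⟨twirl_mem_fixedOps, fun X Y hY => trace_conjTranspose_mul_twirl X Y hY⟩

theorem isOrthogonalProjectionOnto_productTwirl {P : ℕ} (K q : ℕ) (m : Fin P → ℕ) :
    IsOrthogonalProjectionOnto (productTwirl K q m) (⨅ p, fixedOps K q (partyQudits m p)) := by
  have hdisj : ∀ p p', p ≠ p' → Disjoint (partyQudits m p) (partyQudits m p') := by
    intro p p' h
    rw [Finset.disjoint_left]
    intro s hs hs'
    simp only [partyQudits, Finset.mem_filter, Finset.mem_univ, true_and] at hs hs'
    exact h (hs.symm.trans hs')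
  -- The partial product is invariant under every party already twirled, and its pairing with a
  -- jointly invariant operator is unchanged.
  have key : ∀ l : List (Fin P), ∀ X : CopyOp K q (Qudit m),
      (∀ p ∈ l, (l.map fun p => (twirl K q (partyQudits m p) :
        Module.End ℂ (CopyOp K q (Qudit m)))).prod X ∈ fixedOps K q (partyQudits m p)) ∧
      ∀ Y ∈ ⨅ p, fixedOps K q (partyQudits m p), ⟪Y, (l.map fun p =>
        (twirl K q (partyQudits m p) : Module.End ℂ (CopyOp K q (Qudit m)))).prod X⟫_ℂ =
          ⟪Y, X⟫_ℂ := by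
    intro l X
    induction l with
    | nil => simp
    | cons a l ih =>
      rw [List.map_cons, List.prod_cons, Module.End.mul_apply]
      refine ⟨fun p hp => ?_, fun Y hY => ?_⟩
      · by_cases hpa : p = a
        · subst hpa
          exact twirl_mem_fixedOps _
        · intro U
          exact twirl_mem_of_comm (ih.1 p ((List.mem_cons.1 hp).resolve_left hpa) U)
            fun V => onCopies_comm_of_disjoint (hdisj _ _ (Ne.symm hpa)) _ _
      · rw [(isOrthogonalProjectionOnto_twirl K q (partyQudits m a)).inner_eq _ _
          ((Submodule.mem_iInf _).1 hY a), ih.2 Y hY]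
  have hl : productTwirl K q m = ((List.finRange P).map fun p =>
      (twirl K q (partyQudits m p) : Module.End ℂ (CopyOp K q (Qudit m)))).prod := by
    rw [productTwirl, List.ofFn_eq_map]
  rw [hl]
  exact ⟨fun X => (Submodule.mem_iInf _).2 fun p => (key _ X).1 p (List.mem_finRange p),
    fun X Y hY => (key _ X).2 Y hY⟩

end Projection

/-! ### Schur-Weyl duality by polynomial extension and basis maps -/

section SchurWeyl

variable {S : Type*} [Fintype S] [DecidableEq S] {K q : ℕ} {C : Finset S}

theorem onCopies_diagonal (z : (C → Fin q) → ℂ) : onCopies (S := S) K (Matrix.diagonal z) =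
    Matrix.diagonal fun x => ∏ k, z fun s => x k s := by
  have h : ampliate (S := S) (Matrix.diagonal z) = Matrix.diagonal fun x => z fun s => x s := by
    ext x y
    simp only [ampliate, Matrix.of_apply, Matrix.diagonal_apply, ← ite_and]
    refine if_congr ?_ rfl rfl
    simp only [funext_iff, Subtype.forall]
    constructor
    · intro h s
      by_cases hs : s ∈ C
      · exact h.2 s hs
      · exact h.1 s hs
    · exact fun h => ⟨fun s _ => h s, fun s _ => h s⟩
  ext x y
  rw [onCopies, h]
  simp only [tensorPower, Matrix.of_apply, Matrix.diagonal_apply, Finset.prod_ite_zero,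
    Finset.mem_univ, true_imp_iff, funext_iff]

/-- Diagonal unitaries with a phase on a single word `d` force `x` and `y` to contain `d` equally
often among their restrictions to `C`. -/
theorem exists_perm_of_mem_fixedOps {X : CopyOp K q S} (hX : X ∈ fixedOps K q C)
    {x y : Fin K → S → Fin q} (h : X x y ≠ 0) :
    ∃ σ : Equiv.Perm (Fin K), ∀ k, ∀ s ∈ C, x k s = y (σ k) s := by
  suffices h : ∀ d : C → Fin q, (Finset.univ.filter fun k => (fun s : C => x k s) = d).card =
      (Finset.univ.filter fun k => (fun s : C => y k s) = d).card by
    obtain ⟨σ, hσ⟩ := exists_perm_of_card_fiber_eq (fun k => fun s : C => x k s)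
      (fun k => fun s : C => y k s) h
    exact ⟨σ, fun k s hs => congrFun (hσ k) ⟨s, hs⟩⟩
  intro d
  -- The multiplicities range over `0, …, K`, so a root of unity of order `K + 1` separates them.
  have hω := Complex.isPrimitiveRoot_exp (K + 1) K.succ_ne_zero
  set ω := Complex.exp (2 * Real.pi * Complex.I / (K + 1 : ℕ))
  let z : (C → Fin q) → ℂ := fun a => if a = d then ω else 1
  have hz : ∀ a, z a * star (z a) = 1 := by
    intro a
    have hn : ‖z a‖ = 1 := by
      by_cases ha : a = d
      · simp only [z, ha, if_true]
        exact hω.norm'_eq_one K.succ_ne_zero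
      · simp [z, ha]
    rw [Complex.star_def, Complex.mul_conj', hn]
    simp
  have hU : Matrix.diagonal z ∈ Matrix.unitaryGroup (C → Fin q) ℂ := by
    rw [Matrix.mem_unitaryGroup_iff, Matrix.star_eq_conjTranspose, Matrix.diagonal_conjTranspose,
      Matrix.diagonal_mul_diagonal]
    simp only [Pi.star_apply, hz]
    exact Matrix.diagonal_one
  have hc := congrFun (congrFun (hX ⟨_, hU⟩) x) y
  rw [onCopies_diagonal, Matrix.diagonal_mul, Matrix.mul_diagonal, mul_comm] at hc
  have hc := mul_left_cancel₀ h hc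
  have hpow : ∀ w : Fin K → S → Fin q, ∏ k, z (fun s => w k s) =
      ω ^ (Finset.univ.filter fun k => (fun s : C => w k s) = d).card := by
    intro w
    simp only [z, Finset.prod_ite, Finset.prod_const, one_pow, mul_one]
  rw [hpow, hpow] at hc
  have hle : ∀ w : Fin K → S → Fin q,
      (Finset.univ.filter fun k => (fun s : C => w k s) = d).card < K + 1 := fun w =>
    Nat.lt_succ_of_le ((Finset.card_le_univ _).trans (by simp))
  exact hω.pow_inj (hle x) (hle y) hc

theorem onCopies_diagonal_comm {X : CopyOp K q S} (hX : X ∈ fixedOps K q C)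
    (z : (C → Fin q) → ℂ) :
    onCopies K (Matrix.diagonal z) * X = X * onCopies K (Matrix.diagonal z) := by
  ext x y
  rw [onCopies_diagonal, Matrix.diagonal_mul, Matrix.mul_diagonal, mul_comm]
  by_cases h : X x y = 0
  · simp [h]
  obtain ⟨σ, hσ⟩ := exists_perm_of_mem_fixedOps hX h
  congr 1
  rw [← Equiv.prod_comp σ fun k => z fun s => y k s]
  refine Finset.prod_congr rfl fun k _ => ?_
  congr 1
  exact funext fun s => hσ k s s.2

theorem onCopies_isHermitian_comm {X : CopyOp K q S} (hX : X ∈ fixedOps K q C)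
    {A : Matrix (C → Fin q) (C → Fin q) ℂ} (hA : A.IsHermitian) :
    onCopies K A * X = X * onCopies K A := by
  rw [hA.spectral_theorem, Unitary.conjStarAlgAut_apply, onCopies_mul, onCopies_mul]
  have h1 := hX hA.eigenvectorUnitary
  have h2 := onCopies_diagonal_comm hX (RCLike.ofReal ∘ hA.eigenvalues)
  have h3 : onCopies K (star hA.eigenvectorUnitary.1) * X =
      X * onCopies K (star hA.eigenvectorUnitary.1) := hX (star hA.eigenvectorUnitary)
  rw [mul_assoc, h3, mul_assoc, ← mul_assoc _ X, h2, ← mul_assoc, ← mul_assoc, h1]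
  simp only [mul_assoc]

/-- Every element of the commutant of the tensor powers of unitaries commutes with all tensor
powers. -/
theorem onCopies_comm {X : CopyOp K q S} (hX : X ∈ fixedOps K q C)
    (A : Matrix (C → Fin q) (C → Fin q) ℂ) : onCopies K A * X = X * onCopies K A := by
  obtain ⟨H₁, H₂, h₁, h₂, rfl⟩ : ∃ H₁ H₂ : Matrix (C → Fin q) (C → Fin q) ℂ,
      H₁.IsHermitian ∧ H₂.IsHermitian ∧ H₁ + Complex.I • H₂ = A :=
    ⟨_, _, (realPart A).2, (imaginaryPart A).2, realPart_add_I_smul_imaginaryPart A⟩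
  -- The tensor power is not linear in its argument, but the entries of the commutator of `X` with
  -- the tensor power of `H₁ + t H₂` are polynomials in `t`. They vanish for real `t`, where the
  -- argument is Hermitian, hence also at `t = i`.
  let p : (Fin K → S → Fin q) → (Fin K → S → Fin q) → Polynomial ℂ := fun x y =>
    ∏ k, if ∀ s, s ∉ C → x k s = y k s then
      Polynomial.C (H₁ (fun s => x k s) fun s => y k s) +
        Polynomial.X * Polynomial.C (H₂ (fun s => x k s) fun s => y k s) else 0
  have hp : ∀ t x y, (p x y).eval t = onCopies K (H₁ + t • H₂) x y := by
    intro t x y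
    simp only [p, Polynomial.eval_prod, onCopies, tensorPower, ampliate, Matrix.of_apply]
    refine Finset.prod_congr rfl fun k _ => ?_
    split_ifs
    · simp [mul_comm t]
    · simp
  ext x y
  let r : Polynomial ℂ := ∑ w, p x w * Polynomial.C (X w y) - ∑ w, Polynomial.C (X x w) * p w y
  have hr : ∀ t, r.eval t = (onCopies K (H₁ + t • H₂) * X) x y -
      (X * onCopies K (H₁ + t • H₂)) x y := by
    intro t
    simp [r, Polynomial.eval_finsetSum, hp, Matrix.mul_apply]
  have h0 : r = 0 := by
    refine Polynomial.eq_zero_of_infinite_isRoot _ (Set.Infinite.mono ?_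
      (Set.infinite_range_of_injective Complex.ofReal_injective))
    rintro _ ⟨t, rfl⟩
    have hh : (H₁ + (t : ℂ) • H₂).IsHermitian := by
      refine h₁.add ?_
      rw [Matrix.IsHermitian, Matrix.conjTranspose_smul, h₂.eq, Complex.star_def,
        Complex.conj_ofReal]
    rw [Set.mem_ofPred_eq, Polynomial.IsRoot, hr, onCopies_isHermitian_comm hX hh, sub_self]
  have := hr Complex.I
  rw [h0, Polynomial.eval_zero] at this
  exact (sub_eq_zero.1 this.symm)

/-- The matrix that maps the basis vector `y` to the basis vector `F y`. -/
def functionMatrix {n : Type*} [DecidableEq n] (F : n → n) : Matrix n n ℂ :=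
  Matrix.of fun x y => if x = F y then 1 else 0

theorem functionMatrix_comp {n : Type*} [Fintype n] [DecidableEq n] (F G : n → n) :
    functionMatrix (fun x => F (G x)) = functionMatrix F * functionMatrix G := by
  ext x y
  simp [functionMatrix, Matrix.mul_apply]

/-- A map of words applied to each copy is a tensor power of a possibly singular matrix. Commutation
with these is the reason for passing from unitaries to arbitrary matrices. -/
theorem functionMatrix_mul_comm_of_mem_fixedOps {X : CopyOp K q S} (hX : X ∈ fixedOps K q C)
    (f : (C → Fin q) → (C → Fin q)) (F : (Fin K → S → Fin q) → (Fin K → S → Fin q))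
    (hF : ∀ y k s, F y k s = if h : s ∈ C then f (fun s => y k s) ⟨s, h⟩ else y k s) :
    functionMatrix F * X = X * functionMatrix F := by
  have h : functionMatrix F = onCopies (S := S) K (functionMatrix f) := by
    ext x y
    simp only [functionMatrix, onCopies, tensorPower, ampliate, Matrix.of_apply, ← ite_and,
      Finset.prod_ite_zero, Finset.prod_const_one]
    refine if_congr ?_ rfl rfl
    simp only [funext_iff, hF, Finset.mem_univ, true_imp_iff, ← forall_and, Subtype.forall]
    refine forall_congr' fun k => forall_congr' fun s => ?_
    by_cases hs : s ∈ C <;> simp [hs]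
  rw [h, onCopies_comm hX]

variable {ι : Type*} [DecidableEq ι] {c : S → ι} {C : ι → Finset S}

theorem functionMatrix_mul_comm_of_mem_iInf (hC : ∀ p, ∀ s ∈ C p, c s = p) {X : CopyOp K q S}
    (hX : ∀ p, X ∈ fixedOps K q (C p)) (f : ∀ p, (C p → Fin q) → (C p → Fin q))
    (t : Finset ι) :
    functionMatrix (fun (y : Fin K → S → Fin q) k s => if h : s ∈ C (c s) ∧ c s ∈ t then
      f (c s) (fun s => y k s) ⟨s, h.1⟩ else y k s) * X =
    X * functionMatrix (fun (y : Fin K → S → Fin q) k s => if h : s ∈ C (c s) ∧ c s ∈ t then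
      f (c s) (fun s => y k s) ⟨s, h.1⟩ else y k s) := by
  induction t using Finset.induction_on with
  | empty =>
    have h : functionMatrix (fun y : Fin K → S → Fin q => y) = 1 := by
      ext x y
      simp [functionMatrix, Matrix.one_apply]
    simp [h]
  | insert p t hp ih =>
    set F : (Fin K → S → Fin q) → (Fin K → S → Fin q) := fun y k s =>
      if h : s ∈ C (c s) ∧ c s ∈ t then f (c s) (fun s => y k s) ⟨s, h.1⟩ else y k s with hF
    let G : (Fin K → S → Fin q) → (Fin K → S → Fin q) := fun y k s =>
      if h : s ∈ C p then f p (fun s => y k s) ⟨s, h⟩ else y k s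
    have hG := functionMatrix_mul_comm_of_mem_fixedOps (hX p) (f p) G fun y k s => rfl
    have hcomp : (fun (y : Fin K → S → Fin q) k s => if h : s ∈ C (c s) ∧ c s ∈ insert p t then
        f (c s) (fun s => y k s) ⟨s, h.1⟩ else y k s) = fun y => G (F y) := by
      funext y k s
      by_cases hs : s ∈ C p
      · obtain rfl := hC p s hs
        have h1 : (fun s' : C (c s) => F y k s') = fun s' : C (c s) => y k s' := by
          funext s'
          have : c s' = c s := hC _ _ s'.2
          simp [F, this, hp]
        simp only [G, h1]
        simp [hs]
      · have h1 : c s = p → s ∉ C (c s) := fun h => h ▸ hs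
        simp only [G, dif_neg hs, F]
        by_cases h2 : s ∈ C (c s) ∧ c s ∈ t
        · rw [dif_pos h2, dif_pos ⟨h2.1, Finset.mem_insert_of_mem h2.2⟩]
        · rw [dif_neg h2, dif_neg]
          rintro ⟨h3, h4⟩
          rcases Finset.mem_insert.1 h4 with h4 | h4
          · exact h1 h4 h3
          · exact h2 ⟨h3, h4⟩
    rw [hcomp, functionMatrix_comp, mul_assoc, ih, ← mul_assoc, hG, mul_assoc]

/-- Schur-Weyl duality in the regime `K ≤ q ^ #(C p)`: an operator that is invariant under
conjugation by the local unitaries of the disjoint blocks `C p` is a combination of permutations of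
the copies of the blocks, with coefficients that act on the other qudits only. -/
theorem exists_perm_expansion [Fintype ι] (hC : ∀ p, ∀ s ∈ C p, c s = p) (hK : ∀ p, K ≤ q ^ (C p).card)
    {X : CopyOp K q S} (hX : ∀ p, X ∈ fixedOps K q (C p)) :
    ∃ Z : (ι → Equiv.Perm (Fin K)) → CopyOp K q S,
      (∀ π x y x' y', (∀ k s, s ∉ C (c s) → x k s = x' k s) →
        (∀ k s, s ∉ C (c s) → y k s = y' k s) → Z π x y = Z π x' y') ∧
      ∀ x y, X x y = ∑ π : ι → Equiv.Perm (Fin K),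
        if ∀ k, ∀ s, s ∈ C (c s) → x k s = y (π (c s) k) s then Z π x y else 0 := by
  -- The hypothesis `K ≤ q ^ #(C p)` provides `K` distinct reference words in every block; the
  -- coefficients are the entries of `X` at these words.
  have he : ∀ p, Nonempty (Fin K ↪ (C p → Fin q)) := fun p =>
    Function.Embedding.nonempty_of_card_le (by simpa using hK p)
  let e : ∀ p, Fin K ↪ (C p → Fin q) := fun p => (he p).some
  let base : (ι → Equiv.Perm (Fin K)) → (Fin K → S → Fin q) → (Fin K → S → Fin q) :=
    fun π u k s => if h : s ∈ C (c s) then e (c s) (π (c s) k) ⟨s, h⟩ else u k s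
  have hbase : ∀ π u u', (∀ k s, s ∉ C (c s) → u k s = u' k s) → base π u = base π u' := by
    intro π u u' h
    funext k s
    by_cases hs : s ∈ C (c s)
    · simp [base, hs]
    · simp [base, hs, h k s hs]
  refine ⟨fun π => Matrix.of fun x y => X (base π x) (base 1 y), ?_, ?_⟩
  · intro π x y x' y' hx hy
    simp only [Matrix.of_apply]
    rw [hbase π x x' hx, hbase 1 y y' hy]
  intro x y
  -- The basis map sends the reference words to the words of `y`, so commutation with it expresses
  -- the column `y` of `X` by the reference column `base 1 y`.
  let f : ∀ p, (C p → Fin q) → (C p → Fin q) := fun p =>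
    Function.extend (e p) (fun k s => y k s) id
  have hf : ∀ p k, f p (e p k) = fun s : C p => y k s := fun p k =>
    (e p).injective.extend_apply _ _ k
  let F : (Fin K → S → Fin q) → (Fin K → S → Fin q) := fun y k s =>
    if h : s ∈ C (c s) then f (c s) (fun s => y k s) ⟨s, h⟩ else y k s
  have hcomm : functionMatrix F * X = X * functionMatrix F := by
    simpa using functionMatrix_mul_comm_of_mem_iInf hC hX f Finset.univ
  have hbC : ∀ π u k p, (fun s : C p => base π u k s) = e p (π p k) := by
    intro π u k p
    funext s
    obtain ⟨s, hs⟩ := s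
    obtain rfl := hC p s hs
    simp [base, hs]
  have hFb : ∀ π u k s, F (base π u) k s =
      if s ∈ C (c s) then y (π (c s) k) s else u k s := by
    intro π u k s
    by_cases hs : s ∈ C (c s)
    · simp only [F, dif_pos hs, hbC, hf, if_pos hs]
    · simp only [F, dif_neg hs, if_neg hs, base]
  have hFy : F (base 1 y) = y := by
    funext k s
    rw [hFb]
    simp
  have h1 := congrFun (congrFun hcomm x) (base 1 y)
  simp only [Matrix.mul_apply, functionMatrix, Matrix.of_apply, ite_mul, one_mul, zero_mul,
    mul_ite, mul_one, mul_zero, hFy, Finset.sum_ite_eq', Finset.mem_univ, if_true] at h1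
  rw [← h1]
  symm
  -- The nonzero entries of the reference column occur only at permuted reference words; those that
  -- `F` maps to `x` have the form `base π x`, and distinct `π` give distinct words.
  refine Finset.sum_of_injOn (fun π => base π x) ?_ (fun _ _ => Finset.mem_coe.2
    (Finset.mem_univ _)) ?_ ?_
  · intro π _ π' _ h
    funext p
    ext k
    have := congrArg (fun w : Fin K → S → Fin q => fun s : C p => w k s) h
    simp only [hbC] at this
    rw [(e p).injective this]
  · intro w _ hw
    split_ifs with hx
    · by_contra hne
      choose σ hσ using fun p => exists_perm_of_mem_fixedOps (hX p) hne
      refine hw ⟨σ, Finset.mem_coe.2 (Finset.mem_univ _), ?_⟩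
      funext k s
      by_cases hs : s ∈ C (c s)
      · rw [hσ (c s) k s hs]
        simp [base, hs]
      · simp only [base, dif_neg hs]
        rw [hx]
        simp [F, hs]
    · rfl
  · intro π _
    refine if_congr ?_ rfl rfl
    simp only [funext_iff, hFb]
    refine forall_congr' fun k => forall_congr' fun s => ?_
    by_cases hs : s ∈ C (c s) <;> simp [hs]

end SchurWeyl

/-! ### Permutation operators and Schur's test -/

section PermutationOperators

open scoped Matrix.Norms.Frobenius

variable {S : Type*} [Fintype S] {K q : ℕ}

theorem inner_eq_sum {n : Type*} [Fintype n] (X Y : Matrix n n ℂ) :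
    ⟪X, Y⟫_ℂ = ∑ y, ∑ x, star (X x y) * Y x y := by
  rw [inner_eq_trace]
  simp [Matrix.trace, Matrix.mul_apply, Matrix.conjTranspose_apply]

theorem norm_sq_eq_sum {n : Type*} [Fintype n] (X : Matrix n n ℂ) :
    ‖X‖ ^ 2 = ∑ y, ∑ x, ‖X x y‖ ^ 2 := by
  have h := inner_self_eq_norm_sq_to_K (𝕜 := ℂ) X
  rw [inner_eq_sum] at h
  have h2 : ∀ z : ℂ, star z * z = ((‖z‖ ^ 2 : ℝ) : ℂ) := fun z => by
    rw [Complex.star_def, Complex.conj_mul']; push_cast; rfl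
  simp only [h2] at h
  have h3 : ((‖X‖ ^ 2 : ℝ) : ℂ) = ((∑ y, ∑ x, ‖X x y‖ ^ 2 : ℝ) : ℂ) := by
    push_cast at h ⊢
    exact h.symm
  exact_mod_cast h3

/-- The Gram matrix version of Schur's test. -/
theorem norm_sum_smul_sq_le {E I : Type*} [NormedAddCommGroup E] [InnerProductSpace ℂ E]
    [Fintype I] (v : I → E) {H : ℝ} (hH : ∀ i, ∑ j, ‖⟪v i, v j⟫_ℂ‖ ≤ H) (z : I → ℂ) :
    ‖∑ i, z i • v i‖ ^ 2 ≤ H * ∑ i, ‖z i‖ ^ 2 := by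
  have h1 : ‖∑ i, z i • v i‖ ^ 2 ≤ ∑ i, ∑ j, ‖z i‖ * ‖z j‖ * ‖⟪v i, v j⟫_ℂ‖ := by
    rw [← norm_norm (∑ i, z i • v i), ← norm_pow, ← Complex.norm_real, Complex.ofReal_pow]
    have := inner_self_eq_norm_sq_to_K (𝕜 := ℂ) (∑ i, z i • v i)
    erw [← this]
    rw [sum_inner]
    refine (norm_sum_le _ _).trans (Finset.sum_le_sum fun i _ => ?_)
    rw [inner_sum]
    refine (norm_sum_le _ _).trans (Finset.sum_le_sum fun j _ => ?_)
    rw [inner_smul_left, inner_smul_right, norm_mul, norm_mul, RCLike.norm_conj, mul_assoc]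
  have h2 : ∑ i, ∑ j, ‖z i‖ ^ 2 * ‖⟪v i, v j⟫_ℂ‖ ≤ H * ∑ i, ‖z i‖ ^ 2 := by
    rw [Finset.mul_sum]
    refine Finset.sum_le_sum fun i _ => ?_
    rw [← Finset.mul_sum, mul_comm]
    exact mul_le_mul_of_nonneg_right (hH i) (by positivity)
  have h3 : ∑ i, ∑ j, ‖z j‖ ^ 2 * ‖⟪v i, v j⟫_ℂ‖ = ∑ i, ∑ j, ‖z i‖ ^ 2 * ‖⟪v i, v j⟫_ℂ‖ := by
    rw [Finset.sum_comm]
    simp only [norm_inner_symm]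
  have h4 : ∑ i, ∑ j, ‖z i‖ * ‖z j‖ * ‖⟪v i, v j⟫_ℂ‖ ≤
      ∑ i, ∑ j, (‖z i‖ ^ 2 * ‖⟪v i, v j⟫_ℂ‖ + ‖z j‖ ^ 2 * ‖⟪v i, v j⟫_ℂ‖) / 2 := by
    refine Finset.sum_le_sum fun i _ => Finset.sum_le_sum fun j _ => ?_
    -- This is `2uv ≤ u² + v²`, weighted by the Gram entry.
    nlinarith [mul_nonneg (sq_nonneg (‖z i‖ - ‖z j‖)) (norm_nonneg ⟪v i, v j⟫_ℂ)]
  simp only [← Finset.sum_div, Finset.sum_add_distrib, h3] at h4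
  linarith

/-- The operator that permutes the `K` copies of the qudit `s` by `π s`. -/
def permOp (q : ℕ) (π : S → Equiv.Perm (Fin K)) : CopyOp K q S :=
  Matrix.of fun x y => if ∀ k s, x k s = y (π s k) s then 1 else 0

theorem permOp_apply_eq_ite (π : S → Equiv.Perm (Fin K)) (x y : Fin K → S → Fin q) :
    permOp q π x y = if x = fun k s => y (π s k) s then 1 else 0 := by
  simp only [permOp, Matrix.of_apply, funext_iff]

variable [DecidableEq S]

theorem inner_permOp (M : CopyOp K q S) (π : S → Equiv.Perm (Fin K)) :
    ⟪M, permOp q π⟫_ℂ = ∑ y, star (M (fun k s => y (π s k) s) y) := by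
  rw [inner_eq_sum]
  simp [permOp_apply_eq_ite]

theorem inner_permOp_permOp (hq : 1 ≤ q) (π π' : S → Equiv.Perm (Fin K)) :
    ⟪permOp q π, permOp q π'⟫_ℂ =
      (((q : ℝ) ^ (Fintype.card S * K) * ∏ s, fixRatio q (π s * (π' s)⁻¹) : ℝ) : ℂ) := by
  rw [inner_permOp, ← card_agree hq, Finset.card_eq_sum_ones, Finset.sum_filter]
  push_cast
  refine Finset.sum_congr rfl fun y _ => ?_
  simp only [permOp, Matrix.of_apply, Finset.mem_univ, true_imp_iff]
  split_ifs <;> simp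

theorem norm_permOp_sq (hq : 1 ≤ q) (π : S → Equiv.Perm (Fin K)) :
    ‖permOp q π‖ ^ 2 = (q : ℝ) ^ (Fintype.card S * K) := by
  have h := inner_self_eq_norm_sq_to_K (𝕜 := ℂ) (permOp q π)
  rw [inner_permOp_permOp hq] at h
  simp only [mul_inv_cancel, fixRatio_one hq, Finset.prod_const_one, mul_one] at h
  refine Complex.ofReal_injective ?_
  rw [h, Complex.ofReal_pow]
  rfl

theorem norm_sum_permOp_sq_le {I : Type*} [Fintype I] (hq : 1 ≤ q)
    (π : I → S → Equiv.Perm (Fin K)) {H : ℝ}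
    (hH : ∀ i, ∑ j, ∏ s, fixRatio q (π j s * (π i s)⁻¹) ≤ H) (z : I → ℂ) :
    ‖∑ i, z i • permOp q (π i)‖ ^ 2 ≤
      (q : ℝ) ^ (Fintype.card S * K) * H * ∑ i, ‖z i‖ ^ 2 := by
  refine norm_sum_smul_sq_le _ (fun i => ?_) z
  have h : ∀ j, ‖⟪permOp q (π i), permOp q (π j)⟫_ℂ‖ =
      (q : ℝ) ^ (Fintype.card S * K) * ∏ s, fixRatio q (π j s * (π i s)⁻¹) := by
    intro j
    rw [norm_inner_symm, inner_permOp_permOp hq, Complex.norm_real, Real.norm_of_nonneg]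
    exact mul_nonneg (by positivity) (Finset.prod_nonneg fun s _ => fixRatio_nonneg _)
  simp only [h, ← Finset.mul_sum]
  exact mul_le_mul_of_nonneg_left (hH i) (by positivity)

/-- Permuting whole copies only reorders the equal factors of a tensor power. -/
theorem permOp_const_mem_fixedOps (σ : Equiv.Perm (Fin K)) (C : Finset S) :
    permOp q (fun _ => σ) ∈ fixedOps K q C := by
  intro U
  ext x y
  have h1 : ∀ w : Fin K → S → Fin q, permOp q (fun _ => σ) x w =
      if w = fun k => x (σ⁻¹ k) then 1 else 0 := by
    intro w
    rw [permOp_apply_eq_ite]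
    refine if_congr ⟨fun h => ?_, fun h => ?_⟩ rfl rfl <;> subst h <;> funext k s <;> simp
  simp only [Matrix.mul_apply, permOp_apply_eq_ite _ _ y, h1, mul_ite, mul_one, mul_zero, ite_mul,
    one_mul, zero_mul, Finset.sum_ite_eq', Finset.mem_univ, if_true]
  simp only [onCopies, tensorPower, Matrix.of_apply]
  rw [← Equiv.prod_comp σ (fun k => ampliate U.1 (x (σ⁻¹ k)) (y k))]
  simp

end PermutationOperators

/-! ### Operators that permute blocks: the lower Riesz bound and overlaps -/

section BlockOperators

open scoped Matrix.Norms.Frobenius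

variable {S : Type*} [Fintype S] [DecidableEq S] {K q : ℕ} {ι : Type*} {c : S → ι}
  {C : ι → Finset S}

/-- `Z` with the copies of the block `C p` permuted by `π p`. -/
def blockOp (c : S → ι) (C : ι → Finset S) (π : ι → Equiv.Perm (Fin K)) (Z : CopyOp K q S) :
    CopyOp K q S :=
  Matrix.of fun x y => if ∀ k, ∀ s, s ∈ C (c s) → x k s = y (π (c s) k) s then Z x y else 0

/-- The entries of `Z` do not depend on the qudits in the blocks `C p`. -/
def SupportedOffBlocks (c : S → ι) (C : ι → Finset S) (Z : CopyOp K q S) : Prop :=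
  ∀ x y x' y', (∀ k s, s ∉ C (c s) → x k s = x' k s) →
    (∀ k s, s ∉ C (c s) → y k s = y' k s) → Z x y = Z x' y'

theorem sum_ite_agree (A : Finset S) (w : Fin K → S → Fin q) :
    ∑ x : Fin K → S → Fin q, (if ∀ k, ∀ s ∈ A, x k s = w k s then (1 : ℝ) else 0) =
      ∏ s : S, if s ∈ A then 1 else (q : ℝ) ^ K := by
  have h := sum_prod_columns (q := q) (K := K) (fun s v =>
    if s ∈ A → v = fun k => w k s then (1 : ℝ) else 0)
  trans ∏ s, ∑ v : Fin K → Fin q, if s ∈ A → v = fun k => w k s then (1 : ℝ) else 0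
  · rw [← h]
    refine Finset.sum_congr rfl fun x _ => ?_
    rw [Finset.prod_ite_zero]
    simp only [Finset.prod_const_one, Finset.mem_univ, true_imp_iff, funext_iff]
    exact if_congr ⟨fun h s hs k => h k s hs, fun h k s hs => h s hs k⟩ rfl rfl
  · refine Finset.prod_congr rfl fun s _ => ?_
    by_cases hs : s ∈ A <;> simp [hs]

theorem card_copies_pos (hq : 1 ≤ q) : 0 < (Fintype.card (Fin K → S → Fin q) : ℝ) := by
  rw [card_copies]; positivity

theorem sum_prod_injective_ge [DecidableEq ι] (hq : 1 ≤ q) (hC : ∀ p, ∀ s ∈ C p, c s = p)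
    (hK : ∀ p, K ≤ q ^ (C p).card) (hK2 : ∀ p, (K : ℝ) ^ 2 ≤ 2 * (q : ℝ) ^ (C p).card)
    (t : Finset ι) :
    (Fintype.card (Fin K → S → Fin q) : ℝ) *
        ∏ p ∈ t, (1 - (K : ℝ) ^ 2 / (2 * (q : ℝ) ^ (C p).card)) ≤
      ∑ y : Fin K → S → Fin q, ∏ p ∈ t,
        if Function.Injective fun k => fun s : C p => y k s then (1 : ℝ) else 0 := by
  have hN := card_copies_pos (S := S) (K := K) hq
  have hnn : ∀ p, 0 ≤ 1 - (K : ℝ) ^ 2 / (2 * (q : ℝ) ^ (C p).card) := fun p =>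
    sub_nonneg.2 (div_le_one_of_le₀ (hK2 p) (by positivity))
  induction t using Finset.induction_on with
  | empty => simp
  | insert p t hp ih =>
    simp only [Finset.prod_insert hp]
    have hind := sum_mul_sum_of_disjoint_coords (K := K) (q := q) (C p)
      (fun y => if Function.Injective fun k => fun s : C p => y k s then (1 : ℝ) else 0)
      (fun y => ∏ p ∈ t, if Function.Injective fun k => fun s : C p => y k s then (1 : ℝ) else 0)
      (fun x x' h => by
        have : (fun k => fun s : C p => x k s) = fun k => fun s : C p => x' k s := by
          funext k s; exact h k s s.2
        simp only [this])
      (fun x x' h => by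
        refine Finset.prod_congr rfl fun p' hp' => ?_
        have : (fun k => fun s : C p' => x k s) = fun k => fun s : C p' => x' k s := by
          funext k s
          refine h k s fun hs => hp ?_
          rw [← hC p s hs, hC p' s s.2]
          exact hp'
        simp only [this])
    have hinj := card_injective_on hq (C p) (hK p)
    rw [← card_copies, ← Finset.sum_boole] at hinj
    refine le_of_mul_le_mul_left ?_ hN
    rw [hind]
    calc _ = ((Fintype.card (Fin K → S → Fin q) : ℝ) *
          (1 - (K : ℝ) ^ 2 / (2 * (q : ℝ) ^ (C p).card))) *
          ((Fintype.card (Fin K → S → Fin q) : ℝ) *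
          ∏ p ∈ t, (1 - (K : ℝ) ^ 2 / (2 * (q : ℝ) ^ (C p).card))) := by ring
      _ ≤ _ := mul_le_mul hinj ih (mul_nonneg hN.le (Finset.prod_nonneg fun p _ => hnn p))
          (Finset.sum_nonneg fun y _ => by split_ifs <;> simp)

/-- The norm of column `y` depends on `y` only off the blocks, so it is independent of a weight that
depends on `y` only in the blocks. -/
theorem sum_norm_blockOp_sq_mul {Z : CopyOp K q S} (hZ : SupportedOffBlocks c C Z) [DecidableEq ι]
    (π : ι → Equiv.Perm (Fin K)) (g : (Fin K → S → Fin q) → ℝ)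
    (hg : ∀ y y', (∀ k s, s ∈ C (c s) → y k s = y' k s) → g y = g y') :
    (Fintype.card (Fin K → S → Fin q) : ℝ) *
        ∑ y, g y * ∑ x, ‖blockOp c C π Z x y‖ ^ 2 =
      (∑ y, g y) * ‖blockOp c C π Z‖ ^ 2 := by
  set A : Finset S := Finset.univ.filter fun s => s ∈ C (c s) with hA
  have hAm : ∀ s, s ∈ A ↔ s ∈ C (c s) := by simp [hA]
  rw [norm_sq_eq_sum]
  refine sum_mul_sum_of_disjoint_coords A g _ (fun y y' h => hg y y' fun k s hs =>
    h k s ((hAm s).2 hs)) fun y y' h => ?_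
  have key : ∀ y, (Fintype.card (Fin K → S → Fin q) : ℝ) * ∑ x, ‖blockOp c C π Z x y‖ ^ 2 =
      (∏ s : S, if s ∈ A then 1 else (q : ℝ) ^ K) * ∑ x, ‖Z x y‖ ^ 2 := by
    intro y
    rw [← sum_ite_agree A fun k s => y (π (c s) k) s, ← sum_mul_sum_of_disjoint_coords A]
    · congr 1
      refine Finset.sum_congr rfl fun x _ => ?_
      simp only [blockOp, Matrix.of_apply, hAm]
      split_ifs <;> simp
    · intro x x' h
      refine if_congr (forall_congr' fun k => forall₂_congr fun s hs => ?_) rfl rfl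
      rw [h k s hs]
    · intro x x' h
      rw [hZ x y x' y (fun k s hs => h k s (by rwa [hAm])) fun _ _ _ => rfl]
  by_cases hN : (Fintype.card (Fin K → S → Fin q) : ℝ) = 0
  · have : IsEmpty (Fin K → S → Fin q) := Fintype.card_eq_zero_iff.1 (by exact_mod_cast hN)
    exact (this.false y).elim
  · refine mul_left_cancel₀ hN ?_
    rw [key, key]
    congr 1
    refine Finset.sum_congr rfl fun x _ => ?_
    rw [hZ x y x y' (fun _ _ _ => rfl) fun k s hs => h k s (by rwa [hAm])]

/-- On a column whose words are pairwise distinct in each block, at most one `π` contributes to any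
entry, so the squared norms add up exactly. Such columns have at least the stated proportion, and by
independence each summand retains the same share of its norm on them. -/
theorem prod_mul_sum_norm_blockOp_sq_le [Fintype ι] [DecidableEq ι] (hq : 1 ≤ q)
    (hC : ∀ p, ∀ s ∈ C p, c s = p) (hK : ∀ p, K ≤ q ^ (C p).card)
    (hK2 : ∀ p, (K : ℝ) ^ 2 ≤ 2 * (q : ℝ) ^ (C p).card)
    (Z : (ι → Equiv.Perm (Fin K)) → CopyOp K q S) (hZ : ∀ π, SupportedOffBlocks c C (Z π)) :
    (∏ p, (1 - (K : ℝ) ^ 2 / (2 * (q : ℝ) ^ (C p).card))) *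
      ∑ π, ‖blockOp c C π (Z π)‖ ^ 2 ≤ ‖∑ π, blockOp c C π (Z π)‖ ^ 2 := by
  have hN := card_copies_pos (S := S) (K := K) hq
  set good : (Fin K → S → Fin q) → ℝ := fun y => ∏ p,
    if Function.Injective fun k => fun s : C p => y k s then (1 : ℝ) else 0 with hgood
  have hg01 : ∀ y, good y = 0 ∨
      good y = 1 ∧ ∀ p, Function.Injective fun k => fun s : C p => y k s := by
    intro y
    simp only [hgood, Finset.prod_ite_zero, Finset.prod_const_one, Finset.mem_univ, true_imp_iff]
    split_ifs with h
    · exact Or.inr ⟨rfl, h⟩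
    · exact Or.inl rfl
  have hcol : ∀ y, good y * ∑ x, ‖(∑ π, blockOp c C π (Z π)) x y‖ ^ 2 =
      ∑ π, good y * ∑ x, ‖blockOp c C π (Z π) x y‖ ^ 2 := by
    intro y
    rw [← Finset.mul_sum, Finset.sum_comm]
    rcases hg01 y with h0 | ⟨h1, hinj⟩
    · simp [h0]
    congr 1
    refine Finset.sum_congr rfl fun x _ => ?_
    rw [Matrix.sum_apply]
    by_cases hx : ∃ π : ι → Equiv.Perm (Fin K), ∀ k, ∀ s, s ∈ C (c s) → x k s = y (π (c s) k) s
    · obtain ⟨π, hπ⟩ := hx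
      have huniq : ∀ π', π' ≠ π → blockOp c C π' (Z π') x y = 0 := by
        intro π' hne
        simp only [blockOp, Matrix.of_apply]
        rw [if_neg]
        intro h
        refine hne (funext fun p => Equiv.ext fun k => hinj p (funext fun s => ?_))
        obtain ⟨s, hs⟩ := s
        obtain rfl := hC p s hs
        exact (h k s hs).symm.trans (hπ k s hs)
      rw [Finset.sum_eq_single π (fun π' _ h => huniq π' h) (by simp),
        Finset.sum_eq_single π (fun π' _ h => by simp [huniq π' h]) (by simp)]
    · have h0 : ∀ π, blockOp c C π (Z π) x y = 0 := by
        intro π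
        simp only [blockOp, Matrix.of_apply]
        exact if_neg fun h => hx ⟨π, h⟩
      simp [h0]
  have hgc : ∀ y y', (∀ k s, s ∈ C (c s) → y k s = y' k s) → good y = good y' := by
    intro y y' h
    refine Finset.prod_congr rfl fun p _ => ?_
    have : (fun k => fun s : C p => y k s) = fun k => fun s : C p => y' k s := by
      funext k s
      exact h k s (by rw [hC p s s.2]; exact s.2)
    simp only [this]
  have hsum := sum_prod_injective_ge hq hC hK hK2 Finset.univ
  refine le_of_mul_le_mul_left ?_ hN
  calc _ = ((Fintype.card (Fin K → S → Fin q) : ℝ) *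
        ∏ p, (1 - (K : ℝ) ^ 2 / (2 * (q : ℝ) ^ (C p).card))) *
        ∑ π, ‖blockOp c C π (Z π)‖ ^ 2 := by ring
    _ ≤ (∑ y, good y) * ∑ π, ‖blockOp c C π (Z π)‖ ^ 2 :=
        mul_le_mul_of_nonneg_right hsum (Finset.sum_nonneg fun _ _ => by positivity)
    _ = (Fintype.card (Fin K → S → Fin q) : ℝ) *
        ∑ y, good y * ∑ x, ‖(∑ π, blockOp c C π (Z π)) x y‖ ^ 2 := by
        simp only [hcol]
        rw [Finset.sum_comm, Finset.mul_sum, Finset.mul_sum]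
        exact Finset.sum_congr rfl fun π _ => (sum_norm_blockOp_sq_mul (hZ π) π good hgc).symm
    _ ≤ _ := by
        rw [norm_sq_eq_sum]
        refine mul_le_mul_of_nonneg_left (Finset.sum_le_sum fun y _ => ?_) hN.le
        refine mul_le_of_le_one_left (Finset.sum_nonneg fun _ _ => by positivity) ?_
        rcases hg01 y with h | h
        · simp [h]
        · exact h.1.le

/-- Only columns on which `σ` and `π` agree in the blocks contribute. This event depends on block
coordinates and the summand on the others, so its probability splits off as a product of
`fixRatio`s. -/
theorem inner_blockOp_permOp (hq : 1 ≤ q) {Z : CopyOp K q S} (hZ : SupportedOffBlocks c C Z)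
    (σ : ι → Equiv.Perm (Fin K)) (π : S → Equiv.Perm (Fin K)) [DecidableEq ι] :
    ⟪blockOp c C σ Z, permOp q π⟫_ℂ =
      ((∏ s with s ∈ C (c s), fixRatio q (π s * (σ (c s))⁻¹) : ℝ) : ℂ) *
        ⟪blockOp c C σ Z, permOp q fun s => if s ∈ C (c s) then σ (c s) else π s⟫_ℂ := by
  set A : Finset S := Finset.univ.filter fun s => s ∈ C (c s) with hA
  have hAm : ∀ s, s ∈ A ↔ s ∈ C (c s) := by simp [hA]
  have hN : (Fintype.card (Fin K → S → Fin q) : ℂ) ≠ 0 := by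
    exact_mod_cast (card_copies_pos (S := S) (K := K) hq).ne'
  set h : (Fin K → S → Fin q) → ℂ := fun y =>
    star (Z (fun k s => y ((if s ∈ C (c s) then σ (c s) else π s) k) s) y) with hh
  set f : (Fin K → S → Fin q) → ℂ := fun y =>
    if ∀ k, ∀ s ∈ A, y (σ (c s) k) s = y (π s k) s then 1 else 0 with hf
  have h1 : ⟪blockOp c C σ Z, permOp q fun s => if s ∈ C (c s) then σ (c s) else π s⟫_ℂ =
      ∑ y, h y := by
    rw [inner_permOp]
    refine Finset.sum_congr rfl fun y _ => ?_
    simp only [blockOp, Matrix.of_apply]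
    rw [if_pos]
    intro k s hs
    simp [hs]
  have h2 : ⟪blockOp c C σ Z, permOp q π⟫_ℂ = ∑ y, f y * h y := by
    rw [inner_permOp]
    refine Finset.sum_congr rfl fun y _ => ?_
    simp only [blockOp, Matrix.of_apply, hf, hAm, @eq_comm _ (y (π _ _) _), ite_mul, one_mul,
      zero_mul]
    split_ifs
    · rw [hh]
      congr 1
      refine hZ _ _ _ _ (fun k s hs => ?_) fun _ _ _ => rfl
      simp [hs]
    · simp
  have h3 : ∑ y, f y = (Fintype.card (Fin K → S → Fin q) : ℂ) *
      ((∏ s ∈ A, fixRatio q (π s * (σ (c s))⁻¹) : ℝ) : ℂ) := by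
    have := card_agree (q := q) hq A (fun s => σ (c s)) π
    rw [← card_copies] at this
    rw [Finset.sum_boole]
    exact_mod_cast congrArg (fun r : ℝ => (r : ℂ)) this
  have h4 := sum_mul_sum_of_disjoint_coords A f h
    (fun y y' hy => if_congr (forall_congr' fun k => forall₂_congr fun s hs => by
      rw [hy _ s hs, hy _ s hs]) rfl rfl)
    (fun y y' hy => by
      simp only [hh]
      congr 1
      refine hZ _ _ _ _ (fun k s hs => ?_) fun k s hs => hy k s (by rwa [hAm])
      exact hy _ s (by rwa [hAm]))
  refine mul_left_cancel₀ hN ?_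
  rw [h2, h4, h3, h1]
  ring

end BlockOperators

/-! ### Comparison of two quadratic forms on tuples of group elements -/

section Estimates

theorem two_mul_sum_norm_sq_le {I : Type*} (s : Finset I) (w : I → ℂ) :
    2 * ∑ i ∈ s, ‖w i‖ ^ 2 ≤ ‖∑ i ∈ s, w i‖ ^ 2 + (∑ i ∈ s, ‖w i‖) ^ 2 := by
  classical
  induction s using Finset.induction_on with
  | empty => simp
  | insert a s ha ih =>
    rw [Finset.sum_insert ha, Finset.sum_insert ha, Finset.sum_insert ha]
    have h1 : ‖∑ i ∈ s, w i‖ ≤ ∑ i ∈ s, ‖w i‖ := norm_sum_le _ _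
    have h2 := norm_add_sq (𝕜 := ℂ) (w a) (∑ i ∈ s, w i)
    have h3 : -(‖w a‖ * ‖∑ i ∈ s, w i‖) ≤ RCLike.re ⟪w a, ∑ i ∈ s, w i⟫_ℂ :=
      (abs_le.1 (abs_real_inner_le_norm (w a) (∑ i ∈ s, w i))).1
    nlinarith [mul_le_mul_of_nonneg_left h1 (norm_nonneg (w a))]

theorem sum_prod_mul_inv {ι G R : Type*} [Fintype ι] [DecidableEq ι] [Group G] [Fintype G]
    [CommSemiring R] (F : ι → G → R) (π : ι → G) :
    ∑ π' : ι → G, ∏ p, F p (π' p * (π p)⁻¹) = ∏ p, ∑ τ, F p τ := by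
  rw [Fintype.prod_sum]
  exact Fintype.sum_equiv (Equiv.mulRight π⁻¹) _ _ fun π' => rfl

/-- For each `σ`, `two_mul_sum_norm_sq_le` bounds the subtracted square from below by diagonal terms
minus `(∑ |z| h)²`, and Cauchy-Schwarz makes the latter diagonal too. The result has weights `φ (π
σ⁻¹)`. The pointwise hypothesis gives `φ ≥ 0`, so the sum over the diagonal translates may be
enlarged to all tuples. -/
theorem sum_sub_sum_norm_sq_le {ι G : Type*} [Fintype ι] [DecidableEq ι] [Nonempty ι] [Group G]
    [Fintype G] (z : (ι → G) → ℂ) (f h : (ι → G) → ℝ) {A b : ℝ} (hb : 0 ≤ b)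
    (hh : ∀ τ, 0 ≤ h τ) (hfh : ∀ τ, b * h τ ^ 2 ≤ A * f τ) :
    A * ∑ σ : G, ∑ π, ‖z π‖ ^ 2 * f (fun p => π p * σ⁻¹) -
        b * ∑ σ : G, ‖∑ π, z π * (h fun p => π p * σ⁻¹ : ℝ)‖ ^ 2 ≤
      (A * ∑ τ, f τ - 2 * b * ∑ τ, h τ ^ 2 + b * (∑ τ, h τ) ^ 2) * ∑ π, ‖z π‖ ^ 2 := by
  classical
  set H := ∑ τ, h τ with hH
  have hshift : ∀ σ : G, ∑ π : ι → G, h (fun p => π p * σ⁻¹) = H := fun σ =>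
    Fintype.sum_equiv (Equiv.mulRight fun _ => σ⁻¹) _ _ fun π => rfl
  set φ : (ι → G) → ℝ := fun τ => A * f τ - 2 * b * h τ ^ 2 + b * (h τ * H) with hφ
  have hφ0 : ∀ τ, 0 ≤ φ τ := by
    intro τ
    have h1 : h τ ≤ H := Finset.single_le_sum (fun τ _ => hh τ) (Finset.mem_univ τ)
    have h2 : b * h τ ^ 2 ≤ b * (h τ * H) := by
      rw [sq]
      exact mul_le_mul_of_nonneg_left (mul_le_mul_of_nonneg_left h1 (hh τ)) hb
    have := hfh τ
    simp only [hφ]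
    linarith
  have hσ : ∀ σ : G, A * ∑ π, ‖z π‖ ^ 2 * f (fun p => π p * σ⁻¹) -
      b * ‖∑ π, z π * (h fun p => π p * σ⁻¹ : ℝ)‖ ^ 2 ≤
        ∑ π, ‖z π‖ ^ 2 * φ (fun p => π p * σ⁻¹) := by
    intro σ
    have h1 := two_mul_sum_norm_sq_le Finset.univ
      fun π => z π * (h fun p => π p * σ⁻¹ : ℝ)
    simp only [norm_mul, Complex.norm_real, Real.norm_of_nonneg (hh _)] at h1
    have h2 : (∑ π, ‖z π‖ * h fun p => π p * σ⁻¹) ^ 2 ≤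
        (∑ π, ‖z π‖ ^ 2 * h fun p => π p * σ⁻¹) * ∑ π : ι → G, h fun p => π p * σ⁻¹ :=
      Finset.sum_sq_le_sum_mul_sum_of_sq_le_mul _
        (fun π _ => mul_nonneg (sq_nonneg _) (hh _)) (fun π _ => hh _) fun π _ => le_of_eq (by ring)
    rw [hshift] at h2
    have h3 : ∑ π, ‖z π‖ ^ 2 * φ (fun p => π p * σ⁻¹) =
        A * ∑ π, ‖z π‖ ^ 2 * f (fun p => π p * σ⁻¹) -
          b * (2 * ∑ π, (‖z π‖ * h fun p => π p * σ⁻¹) ^ 2) +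
          b * ((∑ π, ‖z π‖ ^ 2 * h fun p => π p * σ⁻¹) * H) := by
      rw [Finset.sum_mul]
      simp only [Finset.mul_sum]
      rw [← Finset.sum_sub_distrib, ← Finset.sum_add_distrib]
      refine Finset.sum_congr rfl fun π _ => ?_
      simp only [hφ]
      ring
    rw [h3]
    nlinarith [mul_le_mul_of_nonneg_left (h1.trans (add_le_add_right h2 _)) hb]
  have hτ : ∀ π : ι → G, ∑ σ : G, φ (fun p => π p * σ⁻¹) ≤ ∑ τ, φ τ := by
    intro π
    -- A single index suffices to recover `σ`, hence the assumption that `ι` is nonempty.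
    have hinj : Function.Injective fun σ : G => fun p => π p * σ⁻¹ := by
      intro σ σ' h
      simpa using congrFun h (Classical.arbitrary ι)
    rw [← Finset.sum_image (f := φ) (g := fun σ : G => fun p => π p * σ⁻¹) hinj.injOn]
    exact Finset.sum_le_univ_sum_of_nonneg hφ0
  calc _ = ∑ σ : G, (A * ∑ π, ‖z π‖ ^ 2 * f (fun p => π p * σ⁻¹) -
        b * ‖∑ π, z π * (h fun p => π p * σ⁻¹ : ℝ)‖ ^ 2) := by
        rw [Finset.sum_sub_distrib, ← Finset.mul_sum, ← Finset.mul_sum]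
    _ ≤ ∑ σ : G, ∑ π, ‖z π‖ ^ 2 * φ (fun p => π p * σ⁻¹) := Finset.sum_le_sum fun σ _ => hσ σ
    _ = ∑ π, ‖z π‖ ^ 2 * ∑ σ : G, φ (fun p => π p * σ⁻¹) := by
        rw [Finset.sum_comm]
        simp only [Finset.mul_sum]
    _ ≤ ∑ π, ‖z π‖ ^ 2 * ∑ τ, φ τ :=
        Finset.sum_le_sum fun π _ => mul_le_mul_of_nonneg_left (hτ π) (sq_nonneg _)
    _ = _ := by
        rw [← Finset.sum_mul, mul_comm]
        congr 1
        simp only [hφ, Finset.sum_add_distrib, Finset.sum_sub_distrib, ← Finset.mul_sum,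
          ← Finset.sum_mul]
        ring

end Estimates

/-! ### The estimates for the product twirl, crosstwirl and full twirl -/

section Multipartite

open scoped Matrix.Norms.Frobenius

variable {P K q : ℕ} {m ℓ : Fin P → ℕ}

theorem prod_qudit {R : Type*} [CommMonoid R] (F : Fin P → R) :
    ∏ s : Qudit m, F s.1 = ∏ p, F p ^ m p := by
  rw [Fintype.prod_sigma]
  simp

theorem card_qudit : Fintype.card (Qudit m) = ∑ p, m p := by
  simp

theorem card_partyQudits (p : Fin P) : (partyQudits m p).card = m p := by
  have h : partyQudits m p = Finset.univ.map (Function.Embedding.sigmaMk p) := by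
    ext ⟨p', i⟩
    simp only [partyQudits, Finset.mem_filter, Finset.mem_univ, true_and, Finset.mem_map,
      Function.Embedding.sigmaMk_apply]
    constructor
    · rintro rfl
      exact ⟨i, rfl⟩
    · rintro ⟨j, hj⟩
      exact (congrArg Sigma.fst hj).symm
  rw [h, Finset.card_map, Finset.card_univ, Fintype.card_fin]

theorem mem_crossQudits (s : Qudit m) : s ∈ crossQudits m ℓ ↔ (s.2 : ℕ) < ℓ s.1 := by
  simp [crossQudits]

theorem card_filter_fin_lt {a b : ℕ} (h : a ≤ b) :
    (Finset.univ.filter fun i : Fin b => (i : ℕ) < a).card = a := by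
  simp [Fin.card_filter_val_lt, h]

theorem prod_crossQudits {R : Type*} [CommMonoid R] (hℓm : ∀ p, ℓ p ≤ m p) (F : Fin P → R) :
    ∏ s ∈ crossQudits m ℓ, F s.1 = ∏ p, F p ^ ℓ p := by
  rw [crossQudits, Finset.prod_filter, Fintype.prod_sigma]
  refine Finset.prod_congr rfl fun p _ => ?_
  dsimp only
  rw [← Finset.prod_filter, Finset.prod_const, card_filter_fin_lt (hℓm p)]

theorem prod_not_crossQudits {R : Type*} [CommMonoid R] (hℓm : ∀ p, ℓ p ≤ m p)
    (F : Fin P → R) :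
    ∏ s : Qudit m, (if s ∈ crossQudits m ℓ then 1 else F s.1) = ∏ p, F p ^ (m p - ℓ p) := by
  simp only [mem_crossQudits]
  rw [Fintype.prod_sigma]
  refine Finset.prod_congr rfl fun p _ => ?_
  dsimp only
  rw [Finset.prod_ite, Finset.prod_const_one, one_mul, Finset.prod_const]
  congr 1
  have h := Finset.card_filter_add_card_filter_not (s := Finset.univ)
    (fun i : Fin (m p) => (i : ℕ) < ℓ p)
  rw [card_filter_fin_lt (hℓm p), Finset.card_univ, Fintype.card_fin] at h
  change (Finset.univ.filter fun i : Fin (m p) => ¬ (i : ℕ) < ℓ p).card = _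
  omega

theorem card_crossQudits (hℓm : ∀ p, ℓ p ≤ m p) : (crossQudits m ℓ).card = ∑ p, ℓ p := by
  have h := prod_crossQudits (m := m) hℓm fun _ => Multiplicative.ofAdd 1
  rw [Finset.prod_const] at h
  have := congrArg Multiplicative.toAdd h
  simpa using this

theorem exists_permOp_expansion (hq : 1 ≤ q) (hKm : ∀ p, K ≤ q ^ m p)
    (hKm2 : ∀ p, K ^ 2 < 2 * q ^ m p) {Y : CopyOp K q (Qudit m)}
    (hY : Y ∈ ⨅ p, fixedOps K q (partyQudits m p)) :
    ∃ z : (Fin P → Equiv.Perm (Fin K)) → ℂ,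
      Y = ∑ π, z π • permOp q (fun s : Qudit m => π s.1) ∧
      (q : ℝ) ^ (Fintype.card (Qudit m) * K) * ∑ π, ‖z π‖ ^ 2 ≤ constA K q m * ‖Y‖ ^ 2 := by
  have hC : ∀ p, ∀ s ∈ partyQudits m p, (Sigma.fst : Qudit m → Fin P) s = p := by
    intro p s hs
    simpa [partyQudits] using hs
  have hact : ∀ s : Qudit m, s ∈ partyQudits m s.1 := by simp [partyQudits]
  obtain ⟨Z, hZ, hYZ⟩ := exists_perm_expansion (K := K) (q := q) hC
    (fun p => by rw [card_partyQudits]; exact hKm p) (fun p => (Submodule.mem_iInf _).1 hY p)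
  -- Every qudit lies in a block, so each `Z π` is constant and any base point reads off its scalar.
  let u : Fin K → Qudit m → Fin q := fun _ _ => ⟨0, hq⟩
  have hblock : ∀ π, blockOp (Sigma.fst : Qudit m → Fin P) (partyQudits m) π (Z π) =
      Z π u u • permOp q (fun s : Qudit m => π s.1) := by
    intro π
    ext x y
    simp only [blockOp, permOp, Matrix.of_apply, Matrix.smul_apply, smul_eq_mul, mul_ite, mul_one,
      mul_zero, hact, true_imp_iff]
    rw [hZ π x y u u (fun k s hs => absurd (hact s) hs) fun k s hs => absurd (hact s) hs]
  have hsum : Y = ∑ π, blockOp (Sigma.fst : Qudit m → Fin P) (partyQudits m) π (Z π) := by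
    ext x y
    rw [hYZ, Matrix.sum_apply]
    rfl
  have hpos : ∀ p, 0 < 1 - (K : ℝ) ^ 2 / (2 * (q : ℝ) ^ m p) := by
    intro p
    have : (K : ℝ) ^ 2 < 2 * (q : ℝ) ^ m p := by exact_mod_cast hKm2 p
    rw [sub_pos, div_lt_one (by positivity)]
    exact this
  refine ⟨fun π => Z π u u, by rw [hsum]; exact Finset.sum_congr rfl fun π _ => hblock π, ?_⟩
  have h := prod_mul_sum_norm_blockOp_sq_le (K := K) hq hC
    (fun p => by rw [card_partyQudits]; exact hKm p)
    (fun p => by rw [card_partyQudits]; exact_mod_cast (hKm2 p).le) Z hZ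
  rw [← hsum] at h
  simp only [hblock, norm_smul, mul_pow, norm_permOp_sq hq, card_partyQudits,
    ← Finset.sum_mul] at h
  rw [constA, Finset.prod_inv_distrib, le_inv_mul_iff₀ (Finset.prod_pos fun p _ => hpos p)]
  linarith [h]

/-- Write `𝒬Y = ∑ M_σ`. Then `‖𝒬Y‖² = ⟪𝒬Y, Y⟫ = ∑ ⟪M_σ, V_σ⟫`, where `V_σ` has `σ` on the
crosstwirled qudits and carries their overlaps as coefficients. Cauchy-Schwarz and `∑ ‖M_σ‖² ≤ c
‖𝒬Y‖²` leave `c ∑ ‖V_σ‖²`, and Schur's test on the other qudits gives `g`. -/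
theorem norm_crossTwirl_sq_le (hq : 1 ≤ q) (hℓm : ∀ p, ℓ p ≤ m p)
    (hKL : K ≤ q ^ ∑ p, ℓ p) (hKL2 : K ^ 2 < 2 * q ^ ∑ p, ℓ p)
    (z : (Fin P → Equiv.Perm (Fin K)) → ℂ) :
    ‖crossTwirl K q m ℓ (∑ π, z π • permOp q (fun s : Qudit m => π s.1))‖ ^ 2 ≤
      (q : ℝ) ^ (Fintype.card (Qudit m) * K) * (constC K q ℓ * constG K q m ℓ *
        ∑ σ : Equiv.Perm (Fin K), ∑ π,
          ‖z π‖ ^ 2 * ∏ p, fixRatio q (π p * σ⁻¹) ^ (2 * ℓ p)) := by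
  set N := (q : ℝ) ^ (Fintype.card (Qudit m) * K) with hNdef
  set Y := ∑ π, z π • permOp q (fun s : Qudit m => π s.1) with hY
  set C : Unit → Finset (Qudit m) := fun _ => crossQudits m ℓ with hCdef
  set c : Qudit m → Unit := fun _ => ()
  have hproj := isOrthogonalProjectionOnto_twirl K q (crossQudits m ℓ)
  obtain ⟨Z, hZ, hQZ⟩ := exists_perm_expansion (K := K) (q := q) (c := c) (C := C)
    (fun _ _ _ => rfl) (fun _ => by rw [hCdef, card_crossQudits hℓm]; exact hKL)
    (X := crossTwirl K q m ℓ Y) (fun _ => hproj.mem Y)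
  set M := fun σ => blockOp c C σ (Z σ) with hM
  have hsum : crossTwirl K q m ℓ Y = ∑ σ, M σ := by
    ext x y
    rw [hQZ, Matrix.sum_apply]
    rfl
  have hpos : 0 < 1 - (K : ℝ) ^ 2 / (2 * (q : ℝ) ^ ∑ p, ℓ p) := by
    have : (K : ℝ) ^ 2 < 2 * (q : ℝ) ^ ∑ p, ℓ p := by exact_mod_cast hKL2
    rw [sub_pos, div_lt_one (by positivity)]
    exact this
  have hlow : ∑ σ, ‖M σ‖ ^ 2 ≤ constC K q ℓ * ‖crossTwirl K q m ℓ Y‖ ^ 2 := by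
    have h := prod_mul_sum_norm_blockOp_sq_le (K := K) (q := q) (c := c) (C := C) hq
      (fun _ _ _ => rfl) (fun _ => by rw [hCdef, card_crossQudits hℓm]; exact hKL)
      (fun _ => by rw [hCdef, card_crossQudits hℓm]; exact_mod_cast hKL2.le) Z hZ
    rw [hsum, constC, le_inv_mul_iff₀ hpos]
    simpa [hCdef, card_crossQudits hℓm] using h
  set r : (Unit → Equiv.Perm (Fin K)) → (Fin P → Equiv.Perm (Fin K)) → ℝ := fun σ π =>
    ∏ p, fixRatio q (π p * (σ ())⁻¹) ^ ℓ p with hr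
  set V : (Unit → Equiv.Perm (Fin K)) → CopyOp K q (Qudit m) := fun σ => ∑ π, (z π * r σ π) •
    permOp q (fun s : Qudit m => if s ∈ crossQudits m ℓ then σ () else π s.1) with hV
  have hinner : ∀ σ, ⟪M σ, Y⟫_ℂ = ⟪M σ, V σ⟫_ℂ := by
    intro σ
    rw [hY, hV, inner_sum, inner_sum]
    refine Finset.sum_congr rfl fun π _ => ?_
    rw [inner_smul_right, inner_smul_right, inner_blockOp_permOp hq (hZ σ), mul_assoc]
    congr 2
    · refine congrArg _ (show _ = ∏ p, fixRatio q (π p * (σ ())⁻¹) ^ ℓ p from ?_)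
      rw [← prod_crossQudits (m := m) hℓm fun p => fixRatio q (π p * (σ ())⁻¹)]
      refine Finset.prod_congr ?_ fun s _ => rfl
      ext s
      simp [hCdef]
  have hVle : ∀ σ, ‖V σ‖ ^ 2 ≤ N * constG K q m ℓ * ∑ π, ‖z π‖ ^ 2 * r σ π ^ 2 := by
    intro σ
    refine (norm_sum_permOp_sq_le hq _ (H := constG K q m ℓ) (fun π => ?_) _).trans_eq ?_
    · have h : ∀ π' : Fin P → Equiv.Perm (Fin K), ∏ s : Qudit m, fixRatio q
          ((if s ∈ crossQudits m ℓ then σ () else π' s.1) *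
            (if s ∈ crossQudits m ℓ then σ () else π s.1)⁻¹) =
          ∏ p, fixRatio q (π' p * (π p)⁻¹) ^ (m p - ℓ p) := by
        intro π'
        rw [← prod_not_crossQudits hℓm]
        refine Finset.prod_congr rfl fun s _ => ?_
        split_ifs
        · rw [mul_inv_cancel, fixRatio_one hq]
        · rfl
      simp only [h]
      rw [sum_prod_mul_inv (fun p τ => fixRatio q τ ^ (m p - ℓ p)) π, constG]
      exact Finset.prod_le_prod
        (fun p _ => Finset.sum_nonneg fun τ _ => pow_nonneg (fixRatio_nonneg τ) _)
        fun p _ => sum_fixRatio_pow_le hq _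
    · congr 1
      refine Finset.sum_congr rfl fun π _ => ?_
      rw [norm_mul, mul_pow, Complex.norm_real, Real.norm_eq_abs, sq_abs]
  have hG0 : 0 ≤ constG K q m ℓ := Finset.prod_nonneg fun p _ => (Real.exp_pos _).le
  have hC0 : 0 ≤ constC K q ℓ := inv_nonneg.2 hpos.le
  have h1 : ‖crossTwirl K q m ℓ Y‖ ^ 2 ≤ ∑ σ, ‖M σ‖ * ‖V σ‖ := by
    have h := hproj.inner_self_apply Y
    change ⟪crossTwirl K q m ℓ Y, Y⟫_ℂ = (‖crossTwirl K q m ℓ Y‖ : ℂ) ^ 2 at h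
    calc ‖crossTwirl K q m ℓ Y‖ ^ 2 = ‖((‖crossTwirl K q m ℓ Y‖ : ℂ) ^ 2)‖ := by
          rw [norm_pow, Complex.norm_real, norm_norm]
      _ = ‖∑ σ, ⟪M σ, V σ⟫_ℂ‖ := by
          rw [← h, hsum, sum_inner]
          simp only [hinner]
      _ ≤ ∑ σ, ‖M σ‖ * ‖V σ‖ := (norm_sum_le _ _).trans
          (Finset.sum_le_sum fun σ _ => norm_inner_le_norm _ _)
  have h2 := Finset.sum_mul_sq_le_sq_mul_sq Finset.univ (fun σ => ‖M σ‖) fun σ => ‖V σ‖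
  have h3 : ‖crossTwirl K q m ℓ Y‖ ^ 2 ≤ constC K q ℓ * ∑ σ, ‖V σ‖ ^ 2 := by
    set x := ‖crossTwirl K q m ℓ Y‖ ^ 2 with hx
    have hV0 : 0 ≤ ∑ σ, ‖V σ‖ ^ 2 := Finset.sum_nonneg fun _ _ => sq_nonneg _
    have hx0 : 0 ≤ x := sq_nonneg _
    have h4 : x * x ≤ x * (constC K q ℓ * ∑ σ, ‖V σ‖ ^ 2) := by
      calc x * x = x ^ 2 := (sq x).symm
        _ ≤ (∑ σ, ‖M σ‖ * ‖V σ‖) ^ 2 := pow_le_pow_left₀ hx0 h1 2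
        _ ≤ (∑ σ, ‖M σ‖ ^ 2) * ∑ σ, ‖V σ‖ ^ 2 := h2
        _ ≤ (constC K q ℓ * x) * ∑ σ, ‖V σ‖ ^ 2 := mul_le_mul_of_nonneg_right hlow hV0
        _ = _ := by ring
    rcases hx0.eq_or_lt with h0 | h0
    · rw [← h0]
      exact mul_nonneg hC0 hV0
    · exact le_of_mul_le_mul_left h4 h0
  refine h3.trans ((mul_le_mul_of_nonneg_left (Finset.sum_le_sum fun σ _ => hVle σ) hC0).trans_eq ?_)
  rw [← Finset.mul_sum]
  have h5 : ∑ σ, ∑ π, ‖z π‖ ^ 2 * r σ π ^ 2 = ∑ σ : Equiv.Perm (Fin K), ∑ π,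
      ‖z π‖ ^ 2 * ∏ p, fixRatio q (π p * σ⁻¹) ^ (2 * ℓ p) := by
    refine Fintype.sum_equiv (Equiv.funUnique Unit _) _ _ fun σ => ?_
    refine Finset.sum_congr rfl fun π _ => ?_
    simp only [hr, ← Finset.prod_pow, ← pow_mul, mul_comm 2]
    rfl
  rw [h5]
  ring

/-- Test `ℛY` against `v = ∑ w_σ σ` in `im ℛ`, whose coefficients are the normalised overlaps of `Y`
with the common permutations. The pairing is `N ∑ |w_σ|²`, while Schur's test gives `‖v‖² ≤ N b⁻¹ ∑
|w_σ|²`. -/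
theorem le_norm_fullTwirl_sq (hq : 1 ≤ q) (z : (Fin P → Equiv.Perm (Fin K)) → ℂ) :
    (q : ℝ) ^ (Fintype.card (Qudit m) * K) * (constB K q m * ∑ σ : Equiv.Perm (Fin K),
        ‖∑ π, z π * (∏ p, fixRatio q (π p * σ⁻¹) ^ m p : ℝ)‖ ^ 2) ≤
      ‖fullTwirl K q m (∑ π, z π • permOp q (fun s : Qudit m => π s.1))‖ ^ 2 := by
  set N := (q : ℝ) ^ (Fintype.card (Qudit m) * K) with hNdef
  have hN : 0 < N := by positivity
  set Y := ∑ π, z π • permOp q (fun s : Qudit m => π s.1) with hY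
  have hproj := isOrthogonalProjectionOnto_twirl K q (Finset.univ : Finset (Qudit m))
  set w : Equiv.Perm (Fin K) → ℂ := fun σ =>
    ∑ π, z π * (∏ p, fixRatio q (π p * σ⁻¹) ^ m p : ℝ) with hw
  set W : Equiv.Perm (Fin K) → CopyOp K q (Qudit m) := fun σ => permOp q fun _ => σ with hW
  set v := ∑ σ, w σ • W σ with hv
  have hinner : ∀ σ, ⟪W σ, Y⟫_ℂ = N * w σ := by
    intro σ
    rw [hY, inner_sum, hw, Finset.mul_sum]
    refine Finset.sum_congr rfl fun π _ => ?_
    rw [inner_smul_right, ← inner_conj_symm, inner_permOp_permOp hq, Complex.conj_ofReal,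
      prod_qudit fun p => fixRatio q (π p * σ⁻¹)]
    push_cast [hNdef]
    ring
  have hmem : v ∈ fixedOps K q (Finset.univ : Finset (Qudit m)) :=
    Submodule.sum_mem _ fun σ _ => Submodule.smul_mem _ _ (permOp_const_mem_fixedOps σ _)
  set T := ∑ σ, ‖w σ‖ ^ 2 with hT
  have hT0 : 0 ≤ T := Finset.sum_nonneg fun _ _ => sq_nonneg _
  have h1 : ⟪v, fullTwirl K q m Y⟫_ℂ = ((N * T : ℝ) : ℂ) := by
    have h := hproj.inner_eq Y v hmem
    change ⟪v, fullTwirl K q m Y⟫_ℂ = _ at h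
    rw [h, hv, sum_inner, hT, Finset.mul_sum, Complex.ofReal_sum]
    refine Finset.sum_congr rfl fun σ _ => ?_
    rw [inner_smul_left, hinner, mul_left_comm, Complex.conj_mul']
    push_cast
    rfl
  have h2 : N * T ≤ ‖v‖ * ‖fullTwirl K q m Y‖ := by
    have h := norm_inner_le_norm (𝕜 := ℂ) v (fullTwirl K q m Y)
    rwa [h1, Complex.norm_real, Real.norm_of_nonneg (mul_nonneg hN.le hT0)] at h
  set E := Real.exp ((K : ℝ) ^ 2 / (2 * (q : ℝ) ^ ∑ p, m p)) with hE
  have h3 : ‖v‖ ^ 2 ≤ N * E * T := by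
    refine norm_sum_permOp_sq_le hq _ (fun σ => ?_) _
    simp only [Finset.prod_const, Finset.card_univ, card_qudit]
    refine le_trans (le_of_eq ?_) (sum_fixRatio_pow_le (K := K) hq (∑ p, m p))
    exact Fintype.sum_equiv (Equiv.mulRight σ⁻¹) _ _ fun _ => rfl
  have hEb : constB K q m * E = 1 := by
    rw [constB, hE, ← Real.exp_add, neg_add_cancel, Real.exp_zero]
  have hb0 : 0 < constB K q m := Real.exp_pos _
  set x := ‖fullTwirl K q m Y‖ with hx
  have h4 : N * T * (N * T) ≤ N * T * (E * x ^ 2) := by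
    calc N * T * (N * T) = (N * T) ^ 2 := (sq _).symm
      _ ≤ (‖v‖ * x) ^ 2 := pow_le_pow_left₀ (mul_nonneg hN.le hT0) h2 2
      _ = ‖v‖ ^ 2 * x ^ 2 := mul_pow _ _ _
      _ ≤ N * E * T * x ^ 2 := mul_le_mul_of_nonneg_right h3 (sq_nonneg _)
      _ = _ := by ring
  have h5 : N * T ≤ E * x ^ 2 := by
    rcases (mul_nonneg hN.le hT0).eq_or_lt with h0 | h0
    · rw [← h0]
      positivity
    · exact le_of_mul_le_mul_left h4 h0
  calc N * (constB K q m * T) = constB K q m * (N * T) := by ring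
    _ ≤ constB K q m * (E * x ^ 2) := mul_le_mul_of_nonneg_left h5 hb0.le
    _ = x ^ 2 := by rw [← mul_assoc, hEb, one_mul]

theorem prod_sum_fixRatio_pow (e : Fin P → ℕ) :
    ∏ p, ∑ τ : Equiv.Perm (Fin K), fixRatio q τ ^ e p =
      ((q : ℝ) ^ ((∑ p, e p) * K))⁻¹ * (K.factorial : ℝ) ^ P *
        ∏ p, (((q ^ e p + K - 1).choose K : ℕ) : ℝ) := by
  simp only [sum_fixRatio_pow]
  rw [Finset.prod_mul_distrib, Finset.prod_mul_distrib, Finset.prod_inv_distrib,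
    Finset.prod_pow_eq_pow_sum, Finset.sum_mul, Finset.prod_const, Finset.card_univ,
    Fintype.card_fin, mul_assoc]

theorem crosstwirlBound_eq : crosstwirlBound K q m ℓ = constA K q m *
    (constC K q ℓ * constG K q m ℓ *
        ∑ τ : Fin P → Equiv.Perm (Fin K), ∏ p, fixRatio q (τ p) ^ (2 * ℓ p)
      - 2 * constB K q m *
        ∑ τ : Fin P → Equiv.Perm (Fin K), (∏ p, fixRatio q (τ p) ^ m p) ^ 2
      + constB K q m *
        (∑ τ : Fin P → Equiv.Perm (Fin K), ∏ p, fixRatio q (τ p) ^ m p) ^ 2) := by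
  simp only [← Finset.prod_pow, ← pow_mul, mul_comm (m _) 2]
  rw [← Fintype.prod_sum fun p τ => fixRatio q τ ^ (2 * ℓ p),
    ← Fintype.prod_sum fun p τ => fixRatio q τ ^ (2 * m p),
    ← Fintype.prod_sum fun p τ => fixRatio q τ ^ m p, prod_sum_fixRatio_pow,
    prod_sum_fixRatio_pow, prod_sum_fixRatio_pow, ← Finset.mul_sum, ← Finset.mul_sum,
    crosstwirlBound, Finset.prod_pow]
  have h : ((q : ℝ) ^ (2 * (∑ p, m p) * K))⁻¹ = (((q : ℝ) ^ ((∑ p, m p) * K))⁻¹) ^ 2 := by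
    rw [inv_pow, ← pow_mul]
    congr 2
    ring
  rw [h, mul_comm 2 P, pow_mul]
  ring

/-- Here `b ≤ 1 ≤ c g`, and `fixRatio ≤ 1` with `2 ℓ p ≤ 2 m p`. This supplies the pointwise
hypothesis of `sum_sub_sum_norm_sq_le`. -/
theorem mul_prod_fixRatio_pow_sq_le (hq : 1 ≤ q) (hℓm : ∀ p, ℓ p ≤ m p)
    (hKL2 : K ^ 2 < 2 * q ^ ∑ p, ℓ p) (τ : Fin P → Equiv.Perm (Fin K)) :
    constB K q m * (∏ p, fixRatio q (τ p) ^ m p) ^ 2 ≤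
      constC K q ℓ * constG K q m ℓ * ∏ p, fixRatio q (τ p) ^ (2 * ℓ p) := by
  have hB : constB K q m ≤ 1 := Real.exp_le_one_iff.2 (neg_nonpos.2 (by positivity))
  have hC : 1 ≤ constC K q ℓ := by
    have : (K : ℝ) ^ 2 < 2 * (q : ℝ) ^ ∑ p, ℓ p := by exact_mod_cast hKL2
    refine (one_le_inv₀ ?_).2 (sub_le_self _ (by positivity))
    rw [sub_pos, div_lt_one (by positivity)]
    exact this
  have hG : 1 ≤ constG K q m ℓ := by
    rw [constG, ← Real.exp_sum]
    exact Real.one_le_exp (Finset.sum_nonneg fun p _ => by positivity)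
  have hle : (∏ p, fixRatio q (τ p) ^ m p) ^ 2 ≤ ∏ p, fixRatio q (τ p) ^ (2 * ℓ p) := by
    rw [← Finset.prod_pow]
    refine Finset.prod_le_prod (fun p _ => sq_nonneg _) fun p _ => ?_
    rw [← pow_mul]
    exact pow_le_pow_of_le_one (fixRatio_nonneg _) (fixRatio_le_one _) (by
      have := hℓm p
      omega)
  calc _ ≤ 1 * (∏ p, fixRatio q (τ p) ^ m p) ^ 2 :=
        mul_le_mul_of_nonneg_right hB (sq_nonneg _)
    _ ≤ constC K q ℓ * constG K q m ℓ * ∏ p, fixRatio q (τ p) ^ (2 * ℓ p) :=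
        mul_le_mul (one_le_mul_of_one_le_of_one_le hC hG) hle (sq_nonneg _) (by positivity)

theorem constA_nonneg (hq : 1 ≤ q) (hKm2 : ∀ p, K ^ 2 < 2 * q ^ m p) : 0 ≤ constA K q m := by
  refine Finset.prod_nonneg fun p _ => inv_nonneg.2 (sub_nonneg.2 (div_le_one_of_le₀ ?_ ?_))
  · exact_mod_cast (hKm2 p).le
  · positivity

theorem norm_crossTwirl_sq_sub_le (hP : 1 ≤ P) (hq : 1 ≤ q) (hℓm : ∀ p, ℓ p ≤ m p)
    (hKm : ∀ p, K ≤ q ^ m p) (hKm2 : ∀ p, K ^ 2 < 2 * q ^ m p) (hKL : K ≤ q ^ ∑ p, ℓ p)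
    (hKL2 : K ^ 2 < 2 * q ^ ∑ p, ℓ p) :
    0 ≤ crosstwirlBound K q m ℓ ∧ ∀ Y ∈ ⨅ p, fixedOps K q (partyQudits m p),
      ‖crossTwirl K q m ℓ Y‖ ^ 2 - ‖fullTwirl K q m Y‖ ^ 2 ≤
        crosstwirlBound K q m ℓ * ‖Y‖ ^ 2 := by
  have : Nonempty (Fin P) := ⟨⟨0, hP⟩⟩
  set A := constC K q ℓ * constG K q m ℓ with hA
  set D := A * ∑ τ : Fin P → Equiv.Perm (Fin K), ∏ p, fixRatio q (τ p) ^ (2 * ℓ p)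
      - 2 * constB K q m *
        ∑ τ : Fin P → Equiv.Perm (Fin K), (∏ p, fixRatio q (τ p) ^ m p) ^ 2
      + constB K q m *
        (∑ τ : Fin P → Equiv.Perm (Fin K), ∏ p, fixRatio q (τ p) ^ m p) ^ 2 with hD
  have hbound : crosstwirlBound K q m ℓ = constA K q m * D := crosstwirlBound_eq
  have ha := constA_nonneg hq hKm2
  have hb : 0 ≤ constB K q m := (Real.exp_pos _).le
  have hh : ∀ τ : Fin P → Equiv.Perm (Fin K), 0 ≤ ∏ p, fixRatio q (τ p) ^ m p := fun τ =>
    Finset.prod_nonneg fun p _ => pow_nonneg (fixRatio_nonneg _) _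
  have hfh := mul_prod_fixRatio_pow_sq_le (K := K) hq hℓm hKL2
  -- The sign matters twice: the bound on `∑ |z_π|²` is multiplied by `D`, and the square root of
  -- the final bound is taken.
  have hD0 : 0 ≤ D := by
    have h1 : constB K q m * ∑ τ : Fin P → Equiv.Perm (Fin K),
        (∏ p, fixRatio q (τ p) ^ m p) ^ 2 ≤
        A * ∑ τ : Fin P → Equiv.Perm (Fin K), ∏ p, fixRatio q (τ p) ^ (2 * ℓ p) := by
      rw [Finset.mul_sum, Finset.mul_sum]
      exact Finset.sum_le_sum fun τ _ => hfh τ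
    have h2 : ∑ τ : Fin P → Equiv.Perm (Fin K), (∏ p, fixRatio q (τ p) ^ m p) ^ 2 ≤
        (∑ τ : Fin P → Equiv.Perm (Fin K), ∏ p, fixRatio q (τ p) ^ m p) ^ 2 :=
      Finset.sum_sq_le_sq_sum_of_nonneg fun τ _ => hh τ
    have h3 := mul_le_mul_of_nonneg_left h2 hb
    rw [hD]
    linarith
  refine ⟨hbound ▸ mul_nonneg ha hD0, fun Y hY => ?_⟩
  obtain ⟨z, hYz, hz⟩ := exists_permOp_expansion hq hKm hKm2 hY
  have h1 := norm_crossTwirl_sq_le hq hℓm hKL hKL2 z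
  have h2 := le_norm_fullTwirl_sq (m := m) hq z
  rw [← hYz] at h1 h2
  have h3 := sum_sub_sum_norm_sq_le z (fun τ => ∏ p, fixRatio q (τ p) ^ (2 * ℓ p))
    (fun τ => ∏ p, fixRatio q (τ p) ^ m p) hb hh hfh
  set N := (q : ℝ) ^ (Fintype.card (Qudit m) * K) with hNdef
  have hN : 0 ≤ N := by positivity
  calc _ ≤ N * (D * ∑ π, ‖z π‖ ^ 2) := by
        have h4 := mul_le_mul_of_nonneg_left h3 hN
        rw [mul_sub] at h4
        linarith
    _ = D * (N * ∑ π, ‖z π‖ ^ 2) := by ring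
    _ ≤ D * (constA K q m * ‖Y‖ ^ 2) := mul_le_mul_of_nonneg_left hz hD0
    _ = _ := by rw [hbound]; ring

end Multipartite

/-! ### The subspace angle and the norm of the difference -/

section MainTheorem

open scoped Matrix.Norms.Frobenius

theorem mainTheorem5 (P K q : ℕ) (hP : 1 ≤ P) (hK : 1 ≤ K) (hq : 1 ≤ q) (m ℓ : Fin P → ℕ)
    (hℓm : ∀ p, ℓ p ≤ m p)
    (hKm : ∀ p, K ≤ q ^ m p)
    (hKm2 : ∀ p, K ^ 2 < 2 * q ^ m p)
    (hKL : K ≤ q ^ ∑ p, ℓ p)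
    (hKL2 : K ^ 2 < 2 * q ^ ∑ p, ℓ p) :
    subspaceAngle (LinearMap.range (productTwirl K q m)) (LinearMap.range (crossTwirl K q m ℓ)) ^ 2
        ≤ crosstwirlBound K q m ℓ ∧
      norm22 (crossTwirl K q m ℓ ∘ₗ productTwirl K q m - fullTwirl K q m) ^ 2
        ≤ crosstwirlBound K q m ℓ := by
  obtain ⟨hB, hY⟩ := norm_crossTwirl_sq_sub_le hP hq hℓm hKm hKm2 hKL hKL2
  have hPr := isOrthogonalProjectionOnto_productTwirl K q m
  have hQ : IsOrthogonalProjectionOnto (crossTwirl K q m ℓ) (fixedOps K q (crossQudits m ℓ)) :=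
    isOrthogonalProjectionOnto_twirl K q _
  have hR : IsOrthogonalProjectionOnto (fullTwirl K q m) (fixedOps K q Finset.univ) :=
    isOrthogonalProjectionOnto_twirl K q _
  have hRP : fixedOps K q (Finset.univ : Finset (Qudit m)) ≤
      ⨅ p, fixedOps K q (partyQudits m p) := le_iInf fun p => fixedOps_univ_le
  have hRQ : fixedOps K q (Finset.univ : Finset (Qudit m)) ≤ fixedOps K q (crossQudits m ℓ) :=
    fixedOps_univ_le
  have hnorm : ∀ X, ‖crossTwirl K q m ℓ (productTwirl K q m X) - fullTwirl K q m X‖ ≤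
      √(crosstwirlBound K q m ℓ) * ‖X‖ := by
    intro X
    refine abs_le_of_sq_le_sq' ?_ (by positivity) |>.2
    rw [mul_pow, Real.sq_sqrt hB]
    exact hPr.norm_comp_sub_sq_le hQ hR hRP hRQ hB hY X
  constructor
  · rw [hPr.range_eq, hQ.range_eq, ← Real.sq_sqrt hB]
    refine pow_le_pow_left₀ (Real.sSup_nonneg ?_) (Real.sSup_le ?_ (Real.sqrt_nonneg _)) 2
    · rintro _ ⟨x, _, y, _, _, _, rfl⟩
      exact norm_nonneg _
    · rintro _ ⟨x, hx, y, hy, hx1, hy1, rfl⟩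
      exact hPr.norm_inner_le_of_norm_comp_sub_le hQ hR hRP hRQ (Real.sqrt_nonneg _) hnorm hx hy.1
        hx1 hy1
  · rw [← Real.sq_sqrt hB]
    refine pow_le_pow_left₀ (Real.iSup_nonneg fun X => by positivity)
      (Real.iSup_le (fun X => ?_) (Real.sqrt_nonneg _)) 2
    exact div_le_of_le_mul₀ (norm_nonneg _) (Real.sqrt_nonneg _) (hnorm X)

end MainTheorem
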